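/- **Conventions.** For a real Banach space $X$ with dual $X^*$, $\Gamma_0(X)$ is the set of proper lower semicontinuous convex functions $X\to\,]-\infty,+\infty]$; $\operatorname{dom}h=\{h<+\infty\}$; $h^*(x^*)=\sup_x(\langle x,x^*\rangle-h(x))$; $\partial h$ is the subdifferential; $\nabla h$ is the Gâteaux gradient. For $h$ Gâteaux differentiable on $\operatorname{int}\operatorname{dom}h\neq\varnothing$, $D^h(x,y)=h(x)-h(y)-\langle x-y,\nabla h(y)\rangle$ if $y\in\operatorname{int}\operatorname{dom}h$, and $D^h(x,y)=+\infty$ otherwise; $D^h_C(y)=\inf_{x\in C}D^h(x,y)$. A function $h\in\Gamma_0(X)$ that is Gâteaux differentiable on $\operatorname{int}\operatorname{dom}h\ne\varnothing$ is *Legendre* if $\partial h$ is locally bounded and single-valued on its domain, $\partial h^*$ is locally bounded on its domain, and $h$ is strictly convex on every convex subset of $\operatorname{dom}\partial h$. It is *cofinite* if $\operatorname{dom}h^*=X^*$. A function $F$ is *coercive* if $F(x)\to+\infty$ as $\|x\|\to+\infty$. $h$ is *uniformly convex at* $x\in\operatorname{dom}h$ if there is a nondecreasing $\phi:[0,+\infty[\to[0,+\infty]$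 vanishing only at $0$ with $h(ax+(1-a)y)+a(1-a)\phi(\|x-y\|)\le a h(x)+(1-a)h(y)$ for all $y\in\operatorname{dom}h$, $a\in]0,1[$. $\operatorname{Prox}^h_{\varphi}(x^*)$ is the set of $x$ at which $\varphi+h-\langle\cdot,x^*\rangle$ attains its minimum, this minimum being $<+\infty$. $\mathfrak W(x_n)$ is the set of weak sequential cluster points of $(x_n)$. For $f\in\Gamma_0(X)$ Gâteaux differentiable on $\operatorname{int}\operatorname{dom}f\neq\varnothing$: $\mathcal B(f)$ is the set of $g\in\Gamma_0(X)$ that are Gâteaux differentiable on $\operatorname{int}\operatorname{dom}g=\operatorname{int}\operatorname{dom}f$; $g_1\succcurlyeq g_2$ means $D^{g_1}(x,y)\ge D^{g_2}(x,y)$ for all $x\in\operatorname{dom}f$, $y\in\operatorname{int}\operatorname{dom}f$; $\mathcal P_\alpha(f)=\{g\in\mathcal B(f): g\succcurlyeq\alpha f\}$. **Theorem.** Let $X,Y$ be reflexive real Banach spaces, $\varphi\in\Gamma_0(X)$, let $\psi\in\Gamma_0(Y)$ be Gâteaux differentiable on $\operatorname{int}\operatorname{dom}\psi\ne\varnothing$,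 let $L:X\to Y$ be linear and bounded, and let $S$ be the set of minimizers of $\varphi+\psi\circ L$ (points where its minimum is attained with a finite value). Let $f\in\Gamma_0(X)$ be Legendre with $S\cap\operatorname{int}\operatorname{dom}f\ne\varnothing$, $L(\operatorname{int}\operatorname{dom}f)\subset\operatorname{int}\operatorname{dom}\psi$, and $f\succcurlyeq\beta\,\psi\circ L$ for some $\beta>0$. Let $(\eta_n)$ be a summable sequence in $[0,+\infty[$, let $\alpha>0$, and let $(f_n)$ be Legendre functions in $\mathcal P_\alpha(f)$ with $(1+\eta_n)f_n\succcurlyeq f_{n+1}$ for all $n\in\mathbb N$. Suppose that either $-L^*(\nabla\psi(\operatorname{int}\operatorname{dom}\psi))\subset\operatorname{dom}\varphi^*$ or every $f_n$ is cofinite. Let $\varepsilon\in\,]0,\alpha\beta/(\alpha\beta+1)[$ and let $(\gamma_n)$ be real numbers with, for all $n$, $$\varepsilon\le\gamma_n\le\alpha\beta(1-\varepsilon)\quad\text{and}\quad(1+\eta_n)\gamma_n-\gamma_{n+1}\le\alpha\beta\eta_n .$$ Let $x_0\in\operatorname{int}\operatorname{dom}f$ and suppose that $D^f(x,\cdot)$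 is coercive for every $x\in\operatorname{int}\operatorname{dom}f$. Then the iteration $$x_{n+1}=\operatorname{Prox}^{f_n}_{\gamma_n\varphi}\big(\nabla f_n(x_n)-\gamma_nL^*\nabla\psi(Lx_n)\big)\qquad(n\in\mathbb N)$$ is well defined (the right-hand side is a singleton at every step), $(x_n)$ is a bounded sequence in $\operatorname{int}\operatorname{dom}f$, and $\mathfrak W(x_n)\subset S$. Moreover, there exists $\overline x\in S$ such that the following hold. 1. If $S\cap\overline{\operatorname{dom}f}$ is a singleton, then $x_n\rightharpoonup\overline x$. 2. Suppose that there is $g\in\mathcal B(f)$ with $g\succcurlyeq f_n$ for all $n$, and that there is $z\in\operatorname{int}\operatorname{dom}f$ such that, for all $y_1,y_2\in\mathfrak W(x_n)$: if $\big(\langle y_1-y_2,\ \nabla f_n(x_n)-\nabla f_n(z)-\gamma_nL^*\nabla\psi(Lx_n)\rangle\big)_{n}$ converges, then $y_1=y_2$. Suppose in addition that (a) $S\subset\operatorname{int}\operatorname{dom}f$, or (b) $\operatorname{dom}f^*$ is open and $\nabla f^*$ is weakly sequentially continuous on it. Then $x_n\rightharpoonup\overline x$. 3. Suppose that, for all bounded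 sequences $(u_n),(v_n)$ in $\operatorname{int}\operatorname{dom}f$, $D^f(u_n,v_n)\to0$ implies $u_n-v_n\to0$, and that one of the following holds: (a) $\varphi$ is uniformly convex at $\overline x$; (b) $\psi$ is uniformly convex at $L\overline x$ and there is $\kappa>0$ with $\|Lx\|\ge\kappa\|x\|$ for all $x\in X$; (c) $\liminf_n D^f_S(x_n)=0$ and there is $\mu>0$ with $\mu f\succcurlyeq f_n$ for all $n$. Then $x_n\to\overline x$. -/

import Mathlib

open Filter Topology
open scoped NNReal ENNReal

noncomputable section

namespace BregmanFB

section General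

variable {E : Type*} [NormedAddCommGroup E] [NormedSpace ℝ E]

/-- Reflexivity: the canonical embedding into the bidual is onto. -/
def IsReflexive (E : Type*) [NormedAddCommGroup E] [NormedSpace ℝ E] : Prop :=
  Function.Surjective (NormedSpace.inclusionInDoubleDual ℝ E)

/-- Weak convergence of a sequence. -/
def WeakTendsto (x : ℕ → E) (y : E) : Prop :=
  ∀ u : StrongDual ℝ E, Tendsto (fun n => u (x n)) atTop (𝓝 (u y))

/-- The set of weak sequential cluster points of a sequence. -/
def weakClusterPts (x : ℕ → E) : Set E :=
  {y | ∃ k : ℕ → ℕ, StrictMono k ∧ WeakTendsto (fun n => x (k n)) y}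

/-- `T` is weakly sequentially continuous on `D`. -/
def WeakSeqContinuousOn {F : Type*} [NormedAddCommGroup F] [NormedSpace ℝ F]
    (T : E → F) (D : Set E) : Prop :=
  ∀ (u : ℕ → E) (v : E), (∀ n, u n ∈ D) → v ∈ D → WeakTendsto u v →
    WeakTendsto (fun n => T (u n)) (T v)

/-- Effective domain. -/
def dom (f : E → EReal) : Set E := {x | f x < ⊤}

/-- Interior of the effective domain. -/
def intDom (f : E → EReal) : Set E := interior (dom f)

/-- Proper lower semicontinuous convex functions with values in `]-∞, +∞]`. -/
structure Gamma0 (f : E → EReal) : Prop where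
  ne_bot : ∀ x, f x ≠ ⊥
  lsc : LowerSemicontinuous f
  convex : ∀ (x y : E) (a b : ℝ), 0 < a → 0 < b → a + b = 1 →
    f (a • x + b • y) ≤ (a : EReal) * f x + (b : EReal) * f y
  proper : (dom f).Nonempty

/-- `u` is the Gâteaux gradient of `f` at `x` (used at interior points of the domain, near which
`f` is finite, so that `f` and `EReal.toReal ∘ f` can be identified). -/
def HasGateauxGrad (f : E → EReal) (u : StrongDual ℝ E) (x : E) : Prop :=
  ∀ v : E, HasLineDerivAt ℝ (fun y => (f y).toReal) (u v) x v

/-- `f` is Gâteaux differentiable at every point of the interior of its domain. -/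
def GateauxDiffOnIntDom (f : E → EReal) : Prop :=
  ∀ x ∈ intDom f, ∃ u : StrongDual ℝ E, HasGateauxGrad f u x

open Classical in
/-- The Gâteaux gradient `∇f(x)` (with value `0` where it does not exist). -/
def grad (f : E → EReal) (x : E) : StrongDual ℝ E :=
  if h : ∃ u : StrongDual ℝ E, HasGateauxGrad f u x then h.choose else 0

open Classical in
/-- The Bregman distance `D^f(x, y)`. -/
def bregman (f : E → EReal) (x y : E) : EReal :=
  if y ∈ intDom f then f x - f y - ((grad f y (x - y) : ℝ) : EReal) else ⊤

/-- The `D^f`-distance to a set `C`. -/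
def bregmanDist (f : E → EReal) (C : Set E) (y : E) : EReal :=
  ⨅ x ∈ C, bregman f x y

/-- The Fenchel conjugate, on the topological dual. -/
def conj (f : E → EReal) (u : StrongDual ℝ E) : EReal :=
  ⨆ x : E, ((u x : ℝ) : EReal) - f x

/-- The Moreau subdifferential. -/
def subdiff (f : E → EReal) (x : E) : Set (StrongDual ℝ E) :=
  {u | ∀ y : E, ((u (y - x) : ℝ) : EReal) + f x ≤ f y}

/-- Domain of the subdifferential. -/
def domSubdiff (f : E → EReal) : Set E := {x | (subdiff f x).Nonempty}

/-- The subdifferential of `f` is locally bounded on its domain. -/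
def SubdiffLocallyBounded (f : E → EReal) : Prop :=
  ∀ x ∈ domSubdiff f, ∃ U ∈ 𝓝 x, Bornology.IsBounded (⋃ y ∈ U, subdiff f y)

/-- Strict convexity of `f` on a set `C`. -/
def StrictlyConvexOn (f : E → EReal) (C : Set E) : Prop :=
  ∀ x ∈ C, ∀ y ∈ C, x ≠ y → ∀ a b : ℝ, 0 < a → 0 < b → a + b = 1 →
    f (a • x + b • y) < (a : EReal) * f x + (b : EReal) * f y

/-- Legendre functions in `Γ₀`: essentially smooth and essentially strictly convex. -/
structure IsLegendre (f : E → EReal) : Prop where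
  gamma0 : Gamma0 f
  intDom_nonempty : (intDom f).Nonempty
  gateaux : GateauxDiffOnIntDom f
  subdiff_locallyBounded : SubdiffLocallyBounded f
  subdiff_subsingleton : ∀ x, (subdiff f x).Subsingleton
  subdiff_conj_locallyBounded : SubdiffLocallyBounded (conj f)
  strictlyConvex : ∀ C : Set E, Convex ℝ C → C ⊆ domSubdiff f → StrictlyConvexOn f C

/-- The class of all `g ∈ Γ₀` that are Gâteaux differentiable on `int dom g = int dom f`. -/
structure MemB (f g : E → EReal) : Prop where
  gamma0 : Gamma0 g
  intDom_eq : intDom g = intDom f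
  gateaux : GateauxDiffOnIntDom g

/-- The order `g₁ ≽ g₂` (relative to `f`) given by comparison of Bregman distances. -/
def Dominates (f g₁ g₂ : E → EReal) : Prop :=
  ∀ x ∈ dom f, ∀ y ∈ intDom f, bregman g₂ x y ≤ bregman g₁ x y

/-- The function `c f`; here `c` is positive wherever it is used. -/
def scale (c : ℝ) (f : E → EReal) : E → EReal := fun x => (c : EReal) * f x

/-- The class of all `g` in `MemB f` with `g ≽ α f`. -/
def MemP (α : ℝ) (f g : E → EReal) : Prop :=
  MemB f g ∧ Dominates f g (scale α f)

/-- Points at which `h` attains its minimum, the minimum being `< +∞`. -/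
def argmin (h : E → EReal) : Set E := {x | h x < ⊤ ∧ ∀ y, h x ≤ h y}

/-- The (set-valued) `f`-proximity operator of `φ`. -/
def prox (f φ : E → EReal) (u : StrongDual ℝ E) : Set E :=
  argmin (fun x => φ x + f x - ((u x : ℝ) : EReal))

/-- `f` is cofinite: its conjugate is finite everywhere. -/
def Cofinite (f : E → EReal) : Prop := dom (conj f) = Set.univ

/-- `h(y) → +∞` as `‖y‖ → +∞`. -/
def Coercive (h : E → EReal) : Prop := Tendsto h (Bornology.cobounded E) (𝓝 ⊤)

/-- `f` is uniformly convex at the point `x` of its domain. -/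
def UniformlyConvexAt (f : E → EReal) (x : E) : Prop :=
  x ∈ dom f ∧ ∃ m : ℝ≥0 → ℝ≥0∞, Monotone m ∧ (∀ t, m t = 0 ↔ t = 0) ∧
    ∀ y ∈ dom f, ∀ a : ℝ, 0 < a → a < 1 →
      f (a • x + (1 - a) • y) + ((a * (1 - a) : ℝ) : EReal) * ((m ‖x - y‖₊ : ℝ≥0∞) : EReal)
        ≤ (a : EReal) * f x + ((1 - a : ℝ) : EReal) * f y

/-- For bounded sequences in `int dom f`, `D^f(xₙ, yₙ) → 0` implies `xₙ - yₙ → 0`. -/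
def BregmanSeqCondition (f : E → EReal) : Prop :=
  ∀ x y : ℕ → E, (∀ n, x n ∈ intDom f) → (∀ n, y n ∈ intDom f) →
    Bornology.IsBounded (Set.range x) → Bornology.IsBounded (Set.range y) →
    Tendsto (fun n => bregman f (x n) (y n)) atTop (𝓝 0) →
    Tendsto (fun n => x n - y n) atTop (𝓝 0)

end General

section Problem

variable {X Y : Type*} [NormedAddCommGroup X] [NormedSpace ℝ X]
  [NormedAddCommGroup Y] [NormedSpace ℝ Y]

/-- The set of minimizers of `φ + ψ ∘ L`. -/
def solutions (φ : X → EReal) (ψ : Y → EReal) (L : X →L[ℝ] Y) : Set X :=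
  argmin (fun x => φ x + ψ (L x))

/-- `L* ∇ψ(L x)`. -/
def pullGrad (ψ : Y → EReal) (L : X →L[ℝ] Y) (x : X) : StrongDual ℝ X :=
  (grad ψ (L x)).comp L

end Problem

end BregmanFB

end

open BregmanFB

/-! The engine is a quasi-Fejér inequality. At a minimizer `p` in `int dom f`, the three-point
identity for `D^{fₙ}` combined with the optimality condition `∇fₙ(xₙ) - γₙ L*∇ψ(Lxₙ) - ∇fₙ(xₙ₊₁) ∈
∂(γₙφ)(xₙ₊₁)` leaves one bad term, `γₙ D^ψ(Lxₙ₊₁, Lxₙ)`. Since `fₙ ≽ αf`, `f ≽ β ψ∘L` and `γₙ ≤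
αβ(1-ε)`, this term is at most `(1-ε) D^{fₙ}(xₙ₊₁, xₙ)` and is absorbed; no Lipschitz gradient is
needed. Passing to `fₙ₊₁` costs a factor `1+ηₙ`. Hence `D^{fₙ}(p, xₙ)` converges, and the
nonnegative decrements (`decrement`) tend to zero. One part of the decrement is `γₙ` times the
objective gap and `γₙ ≥ ε`, so the objective values tend to the minimum. Coercivity of `D^f(p, ·)`
bounds the orbit, and weak lower semicontinuity puts its weak cluster points in `S`.

The step is well defined by two facts about Legendre functions. Local boundedness of `∂f*` makes the
sublevel sets of `f - u` bounded for every `u` in the range of `∂f`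
(`IsLegendre.isBounded_sublevel`), so minimizers exist; uniqueness of subgradients forces `dom ∂f ⊆
int dom f`, so minimizers are interior. The convex analysis rests on two tools: a Hahn–Banach
sandwich theorem (`exists_affine_between`), which acts as sum rule, and a variational principle with
the perturbation `c‖· - y‖` (`Gamma0.exists_small_subgradient`), which in reflexive spaces acts as a
Brøndsted–Rockafellar theorem.

The point `x̄` is any weak cluster point; weak convergence amounts to its uniqueness. In case 2 all
cluster points are interior solutions (under (b), because `∇f*` carries weak limits of the gradients
back to `int dom f`), and the pairing in the separation condition converges because it is a
combination of convergent Bregman distances. In case 3, uniform convexity bounds the distance to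
`x̄` by the objective gap; under (c), Bregman projections onto `S` show that the orbit is Cauchy. -/

namespace BregmanFB

set_option linter.unusedSectionVars false

/-! ### Weak sequential compactness in reflexive spaces -/

section Weak

variable {E : Type*} [NormedAddCommGroup E] [NormedSpace ℝ E]

theorem mem_of_weakTendsto {C : Set E} (hC : Convex ℝ C) (hcl : IsClosed C) {x : ℕ → E} {y : E}
    (hx : ∀ᶠ n in atTop, x n ∈ C) (h : WeakTendsto x y) : y ∈ C := by
  by_contra hy
  obtain ⟨u, c, h1, h2⟩ := geometric_hahn_banach_closed_point hC hcl hy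
  exact absurd (le_of_tendsto (h u) (hx.mono fun n hn => (h1 _ hn).le)) (not_le.2 h2)

theorem WeakTendsto.comp {x : ℕ → E} {y : E} (h : WeakTendsto x y) {k : ℕ → ℕ}
    (hk : StrictMono k) : WeakTendsto (fun n => x (k n)) y :=
  fun u => (h u).comp hk.tendsto_atTop

theorem WeakTendsto.unique {x : ℕ → E} {y z : E} (h : WeakTendsto x y) (h' : WeakTendsto x z) :
    y = z := by
  by_contra hne
  obtain ⟨u, hu⟩ := SeparatingDual.exists_ne_zero (R := ℝ) (sub_ne_zero.2 hne)
  exact hu (by rw [map_sub, sub_eq_zero]; exact tendsto_nhds_unique (h u) (h' u))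

/-- Banach–Alaoglu in the bidual, pulled back to `E` by reflexivity. The limit is only along an
ultrafilter; sequences are reached through separability below. -/
theorem IsReflexive.exists_ultrafilter_limit (hE : IsReflexive E) {x : ℕ → E} {R : ℝ}
    (hx : ∀ n, ‖x n‖ ≤ R) (F : Ultrafilter ℕ) :
    ∃ y : E, ∀ u : StrongDual ℝ E, Tendsto (fun n => u (x n)) F (𝓝 (u y)) := by
  let T : ℕ → WeakDual ℝ (StrongDual ℝ E) := fun n =>
    StrongDual.toWeakDual (NormedSpace.inclusionInDoubleDual ℝ E (x n))
  have hc := WeakDual.isCompact_closedBall (𝕜 := ℝ) (E := StrongDual ℝ E) 0 R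
  obtain ⟨z, -, hz⟩ := hc.ultrafilter_le_nhds (F.map T) (by
    refine le_principal_iff.2 (Filter.mem_map.2 (Filter.univ_mem' fun n => ?_))
    have : NormedSpace.inclusionInDoubleDual ℝ E (x n) ∈
        Metric.closedBall (0 : StrongDual ℝ (StrongDual ℝ E)) R :=
      (mem_closedBall_zero_iff (E := StrongDual ℝ (StrongDual ℝ E))).2
        ((NormedSpace.double_dual_bound ℝ E (x n)).trans (hx n))
    exact this)
  obtain ⟨y, hy⟩ := hE (WeakDual.toStrongDual z)
  refine ⟨y, fun u => ?_⟩
  have h1 := (tendsto_iff_forall_eval_tendsto_topDualPairing (𝕜 := ℝ)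
    (f := T) (l := (F : Filter ℕ)) (x := z)).1 hz u
  have h2 : u y = z u := by
    rw [← NormedSpace.dual_def ℝ E y u, hy]; rfl
  rw [h2]
  exact h1

/-- Bounded sequences in a reflexive space have weakly convergent subsequences. -/
theorem IsReflexive.exists_weakTendsto_subseq (hE : IsReflexive E) {x : ℕ → E} {R : ℝ}
    (hx : ∀ n, ‖x n‖ ≤ R) : ∃ y : E, ∃ k : ℕ → ℕ, StrictMono k ∧
      WeakTendsto (fun n => x (k n)) y := by
  classical
  -- The closed span of the sequence is separable, so countably many functionals separate its points
  -- and a diagonal subsequence makes all of them converge.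
  let M : Submodule ℝ E := (Submodule.span ℝ (Set.range x)).topologicalClosure
  have hMsep : TopologicalSpace.IsSeparable (M : Set E) := by
    rw [Submodule.topologicalClosure_coe]
    exact ((Set.countable_range x).isSeparable.span (R := ℝ)).closure
  have hxM : ∀ n, x n ∈ M := fun n =>
    Submodule.le_topologicalClosure _ (Submodule.subset_span ⟨n, rfl⟩)
  obtain ⟨c, hc, hMc⟩ := hMsep
  have hcne : c.Nonempty := by
    rcases c.eq_empty_or_nonempty with h | h
    · rw [h, closure_empty] at hMc
      exact absurd (hMc (hxM 0)) (Set.notMem_empty _)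
    · exact h
  obtain ⟨m, rfl⟩ := hc.exists_eq_range hcne
  -- Norming functionals of a dense sequence: if every `d j` vanishes at `z ∈ M`, then `‖m j‖ ≤ ‖z -
  -- m j‖`, and taking `m j` close to `z` gives `z = 0`.
  choose d hd1 hd2 using fun j => exists_dual_vector'' ℝ (m j)
  have hsep : ∀ z ∈ M, (∀ j, d j z = 0) → z = 0 := by
    intro z hz h0
    rw [← norm_le_zero_iff]
    refine le_of_forall_pos_le_add fun e he => ?_
    obtain ⟨_, ⟨j, rfl⟩, hj⟩ := Metric.mem_closure_iff.1 (hMc hz) (e / 2) (by positivity)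
    rw [dist_eq_norm] at hj
    have h1 : ‖m j‖ ≤ ‖z - m j‖ := by
      have h2 : d j (m j - z) = ‖m j‖ := by rw [map_sub, h0 j, hd2 j]; simp
      calc ‖m j‖ = d j (m j - z) := h2.symm
        _ ≤ ‖d j (m j - z)‖ := le_abs_self _
        _ ≤ ‖d j‖ * ‖m j - z‖ := (d j).le_opNorm _
        _ ≤ 1 * ‖m j - z‖ := by gcongr; exact hd1 j
        _ = ‖z - m j‖ := by rw [one_mul, norm_sub_rev]
    have h3 : ‖z‖ ≤ ‖z - m j‖ + ‖m j‖ := by simpa using norm_add_le (z - m j) (m j)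
    linarith
  have hcomp : IsCompact (Set.pi Set.univ fun _ : ℕ => Set.Icc (-R) R) :=
    isCompact_univ_pi fun _ => isCompact_Icc
  obtain ⟨a, -, k, hk, hlim⟩ := hcomp.tendsto_subseq (x := fun n j => d j (x n)) (by
    intro n j _
    have : |d j (x n)| ≤ R := by
      calc |d j (x n)| ≤ ‖d j‖ * ‖x n‖ := (d j).le_opNorm _
        _ ≤ 1 * ‖x n‖ := by gcongr; exact hd1 j
        _ ≤ R := by rw [one_mul]; exact hx n
    exact abs_le.1 this)
  -- Every ultrafilter limit lies in `M` and has the prescribed values `a j`, so all of them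
  -- coincide; this is convergence of the whole subsequence.
  have key : ∀ F : Ultrafilter ℕ, (F : Filter ℕ) ≤ atTop → ∀ y : E,
      (∀ u : StrongDual ℝ E, Tendsto (fun n => u (x (k n))) F (𝓝 (u y))) →
      y ∈ M ∧ ∀ j, d j y = a j := by
    intro F hF y hy
    refine ⟨?_, fun j => ?_⟩
    · by_contra hyM
      obtain ⟨u, c, h1, h2⟩ := geometric_hahn_banach_closed_point (s := (M : Set E)) M.convex
        (Submodule.isClosed_topologicalClosure _) hyM
      exact absurd (le_of_tendsto (hy u) (Filter.univ_mem' fun n => (h1 _ (hxM (k n))).le))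
        (not_le.2 h2)
    · exact tendsto_nhds_unique (hy (d j)) (((tendsto_pi_nhds.1 hlim) j).mono_left hF)
  let F₀ : Ultrafilter ℕ := Ultrafilter.of atTop
  obtain ⟨y, hy⟩ := hE.exists_ultrafilter_limit (fun n => hx (k n)) F₀
  obtain ⟨hyM, hya⟩ := key F₀ (Ultrafilter.of_le _) y hy
  refine ⟨y, k, hk, fun u => tendsto_iff_ultrafilter _ _ _ |>.2 fun F hF => ?_⟩
  obtain ⟨z, hz⟩ := hE.exists_ultrafilter_limit (fun n => hx (k n)) F
  obtain ⟨hzM, hza⟩ := key F hF z hz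
  have : z - y = 0 := hsep _ (M.sub_mem hzM hyM) fun j => by rw [map_sub, hza, hya, sub_self]
  rw [← sub_eq_zero.1 this]
  exact hz u

/-- If `J` is the canonical map of `E`, a functional `Φ` on the bidual is evaluation at `Φ ∘ J`,
because every element of the bidual is some `J x`. -/
theorem IsReflexive.dual (hE : IsReflexive E) : IsReflexive (StrongDual ℝ E) := by
  intro Φ
  refine ⟨Φ.comp (NormedSpace.inclusionInDoubleDual ℝ E), ?_⟩
  ext ζ
  obtain ⟨x, rfl⟩ := hE ζ
  simp [NormedSpace.dual_def]

theorem IsReflexive.weakClusterPts_nonempty (hE : IsReflexive E) {x : ℕ → E}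
    (hx : Bornology.IsBounded (Set.range x)) : (weakClusterPts x).Nonempty := by
  obtain ⟨R, hR⟩ := hx.exists_norm_le
  exact (hE.exists_weakTendsto_subseq fun n => hR _ ⟨n, rfl⟩)

theorem IsReflexive.weakTendsto_of_weakClusterPts (hE : IsReflexive E) {x : ℕ → E} {y : E}
    (hx : Bornology.IsBounded (Set.range x)) (h : ∀ z ∈ weakClusterPts x, z = y) :
    WeakTendsto x y := by
  obtain ⟨R, hR⟩ := hx.exists_norm_le
  intro u
  refine tendsto_of_subseq_tendsto fun ns hns => ?_
  obtain ⟨k, hk, hk'⟩ := strictMono_subseq_of_tendsto_atTop hns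
  obtain ⟨z, l, hl, hz⟩ := hE.exists_weakTendsto_subseq (x := fun n => x (ns (k n)))
    fun n => hR _ ⟨_, rfl⟩
  have := h z ⟨_, hk'.comp hl, hz⟩
  subst this
  exact ⟨fun n => k (l n), hz u⟩

end Weak

/-! ### Functions in `Γ₀`: minimizers, local bounds, the sandwich theorem -/

section Convex

variable {E : Type*} [NormedAddCommGroup E] [NormedSpace ℝ E]

theorem Gamma0.coe_toReal {h : E → EReal} (hh : Gamma0 h) {x : E} (hx : x ∈ dom h) :
    ((h x).toReal : EReal) = h x :=
  EReal.coe_toReal (ne_of_lt hx) (hh.ne_bot x)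

theorem intDom_subset_dom (h : E → EReal) : intDom h ⊆ dom h := interior_subset

theorem mem_dom_of_le_coe {h : E → EReal} {x : E} {c : ℝ} (hx : h x ≤ c) : x ∈ dom h :=
  hx.trans_lt (EReal.coe_lt_top c)

theorem Gamma0.toReal_le {h : E → EReal} (hh : Gamma0 h) {x : E} {c : ℝ} (hx : h x ≤ c) :
    (h x).toReal ≤ c := by
  rw [← EReal.coe_le_coe_iff, hh.coe_toReal (mem_dom_of_le_coe hx)]
  exact hx

/-- Convexity along a segment, for real upper bounds. -/
theorem Gamma0.le_combo {h : E → EReal} (hh : Gamma0 h) {x y : E} {s t a b : ℝ}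
    (hx : h x ≤ s) (hy : h y ≤ t) (ha : 0 ≤ a) (hb : 0 ≤ b) (hab : a + b = 1) :
    h (a • x + b • y) ≤ ((a * s + b * t : ℝ) : EReal) := by
  rcases ha.eq_or_lt with rfl | ha'
  · obtain rfl : b = 1 := by linarith
    simpa using hy
  rcases hb.eq_or_lt with rfl | hb'
  · obtain rfl : a = 1 := by linarith
    simpa using hx
  refine (hh.convex x y a b ha' hb' hab).trans ?_
  push_cast
  exact add_le_add (mul_le_mul_of_nonneg_left hx (by exact_mod_cast ha))
    (mul_le_mul_of_nonneg_left hy (by exact_mod_cast hb))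

theorem Gamma0.convex_dom {h : E → EReal} (hh : Gamma0 h) : Convex ℝ (dom h) := by
  intro x hx y hy a b ha hb hab
  exact mem_dom_of_le_coe (hh.le_combo (hh.coe_toReal hx).ge (hh.coe_toReal hy).ge ha hb hab)

theorem Gamma0.toReal_combo_le {h : E → EReal} (hh : Gamma0 h) {x y : E} (hx : x ∈ dom h)
    (hy : y ∈ dom h) {a b : ℝ} (ha : 0 ≤ a) (hb : 0 ≤ b) (hab : a + b = 1) :
    (h (a • x + b • y)).toReal ≤ a * (h x).toReal + b * (h y).toReal :=
  hh.toReal_le (hh.le_combo (hh.coe_toReal hx).ge (hh.coe_toReal hy).ge ha hb hab)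

theorem Gamma0.convex_le {h : E → EReal} (hh : Gamma0 h) (c : EReal) :
    Convex ℝ {x | h x ≤ c} := by
  induction c with
  | bot =>
    have : {x | h x ≤ ⊥} = ∅ := by
      ext x; simpa using hh.ne_bot x
    rw [this]; exact convex_empty
  | top => simpa using convex_univ
  | coe c =>
    intro x hx y hy a b ha hb hab
    have := hh.le_combo hx hy ha hb hab
    rwa [← add_mul, hab, one_mul] at this

theorem Gamma0.isClosed_le {h : E → EReal} (hh : Gamma0 h) (c : EReal) :
    IsClosed {x | h x ≤ c} := hh.lsc.isClosed_preimage c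

/-- Weak sequential lower semicontinuity. -/
theorem Gamma0.le_of_weakTendsto {h : E → EReal} (hh : Gamma0 h) {x : ℕ → E} {y : E}
    (hxy : WeakTendsto x y) {m : EReal} (hm : ∀ c : ℝ, m < c → ∀ᶠ n in atTop, h (x n) ≤ c) :
    h y ≤ m := by
  refine EReal.le_of_forall_lt_iff_le.1 fun c hc => ?_
  exact mem_of_weakTendsto (hh.convex_le c) (hh.isClosed_le c) (hm c hc) hxy

/-- Existence of minimizers in reflexive spaces. -/
theorem Gamma0.exists_forall_le (hE : IsReflexive E) {h : E → EReal} (hh : Gamma0 h)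
    (hb : ∀ c : ℝ, Bornology.IsBounded {x | h x ≤ c}) : ∃ z ∈ dom h, ∀ y, h z ≤ h y := by
  obtain ⟨x₀, hx₀⟩ := hh.proper
  obtain ⟨v, hv, hlim, hmem⟩ := exists_seq_tendsto_sInf (Set.range_nonempty_iff_nonempty.2 ⟨x₀⟩)
    (OrderBot.bddBelow (Set.range h))
  choose x hx using hmem
  set m := sInf (Set.range h) with hm
  have hmle : ∀ y, m ≤ h y := fun y => sInf_le ⟨y, rfl⟩
  have hev : ∀ c : ℝ, m < c → ∀ᶠ n in atTop, h (x n) ≤ c := fun c hc => by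
    filter_upwards [hlim.eventually_lt_const hc] with n hn
    rw [hx]; exact hn.le
  have hmtop : m < ⊤ := (hmle x₀).trans_lt hx₀
  obtain ⟨c, hmc, -⟩ := EReal.lt_iff_exists_real_btwn.1 hmtop
  obtain ⟨N, hN⟩ := eventually_atTop.1 (hev c hmc)
  obtain ⟨R, hR⟩ := (hb c).exists_norm_le
  obtain ⟨y, k, hk, hy⟩ := hE.exists_weakTendsto_subseq (x := fun n => x (N + n)) (R := R)
    fun n => hR _ (hN _ (Nat.le_add_right _ _))
  have hym : h y ≤ m := hh.le_of_weakTendsto hy fun c hc => by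
    have h1 : Tendsto (fun n => N + k n) atTop atTop :=
      tendsto_atTop_mono (fun n => Nat.le_add_left _ _) hk.tendsto_atTop
    exact h1.eventually (hev c hc)
  exact ⟨y, hym.trans_lt hmtop, fun w => hym.trans (hmle w)⟩

theorem dom_add {g h : E → EReal} (hg : ∀ x, g x ≠ ⊥) (hh : ∀ x, h x ≠ ⊥) :
    dom (fun x => g x + h x) = dom g ∩ dom h := by
  ext x
  simp only [dom, Set.mem_ofPred_eq, Set.mem_inter_iff, lt_top_iff_ne_top]
  exact EReal.add_ne_top_iff_ne_top₂ (hg x) (hh x)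

theorem Gamma0.add {g h : E → EReal} (hg : Gamma0 g) (hh : Gamma0 h)
    (hd : (dom g ∩ dom h).Nonempty) : Gamma0 (fun x => g x + h x) where
  ne_bot x := EReal.add_ne_bot_iff.2 ⟨hg.ne_bot x, hh.ne_bot x⟩
  lsc := hg.lsc.add' hh.lsc fun x =>
    EReal.continuousAt_add (Or.inr (hh.ne_bot x)) (Or.inl (hg.ne_bot x))
  convex x y a b ha hb hab := by
    refine (add_le_add (hg.convex x y a b ha hb hab) (hh.convex x y a b ha hb hab)).trans ?_
    rw [EReal.left_distrib_of_nonneg_of_ne_top (by exact_mod_cast ha.le) (EReal.coe_ne_top a),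
      EReal.left_distrib_of_nonneg_of_ne_top (by exact_mod_cast hb.le) (EReal.coe_ne_top b),
      add_add_add_comm]
  proper := by rwa [dom_add hg.ne_bot hh.ne_bot]

theorem dom_scale {c : ℝ} (hc : 0 < c) (h : E → EReal) : dom (scale c h) = dom h := by
  ext x
  simp only [dom, scale, Set.mem_ofPred_eq]
  induction h x with
  | bot => simp [EReal.coe_mul_bot_of_pos hc]
  | top => simp [EReal.coe_mul_top_of_pos hc]
  | coe r => exact iff_of_true (EReal.coe_lt_top (c * r)) (EReal.coe_lt_top r)

theorem intDom_scale {c : ℝ} (hc : 0 < c) (h : E → EReal) : intDom (scale c h) = intDom h := by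
  rw [intDom, dom_scale hc, intDom]

theorem Gamma0.scale {c : ℝ} (hc : 0 < c) {h : E → EReal} (hh : Gamma0 h) :
    Gamma0 (scale c h) where
  ne_bot x := by
    simp only [BregmanFB.scale]
    have := hh.ne_bot x
    induction hx : h x with
    | bot => exact absurd hx this
    | top => simp [EReal.coe_mul_top_of_pos hc]
    | coe r => rw [← EReal.coe_mul]; exact EReal.coe_ne_bot _
  lsc := by
    refine lowerSemicontinuous_iff_isClosed_preimage.2 fun y => ?_
    have : BregmanFB.scale c h ⁻¹' Set.Iic y = h ⁻¹' Set.Iic (y / c) := by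
      ext x
      simp only [BregmanFB.scale, Set.mem_preimage, Set.mem_Iic]
      rw [EReal.le_div_iff_mul_le (by exact_mod_cast hc) (EReal.coe_ne_top c), mul_comm]
    rw [this]
    exact hh.lsc.isClosed_preimage _
  convex x y a b ha hb hab := by
    simp only [BregmanFB.scale]
    have hc0 : (0 : EReal) ≤ c := by exact_mod_cast hc.le
    refine (mul_le_mul_of_nonneg_left (hh.convex x y a b ha hb hab) hc0).trans_eq ?_
    rw [EReal.left_distrib_of_nonneg_of_ne_top hc0 (EReal.coe_ne_top c), mul_left_comm,
      mul_left_comm (c : EReal) (b : EReal)]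
  proper := by rw [dom_scale hc]; exact hh.proper

theorem Gamma0.of_real {r : E → ℝ} (hr : ConvexOn ℝ Set.univ r) (hc : Continuous r) :
    Gamma0 (fun x => (r x : EReal)) where
  ne_bot x := EReal.coe_ne_bot _
  lsc := (continuous_coe_real_ereal.comp hc).lowerSemicontinuous
  convex x y a b ha hb hab := by
    exact_mod_cast hr.2 (Set.mem_univ x) (Set.mem_univ y) ha.le hb.le hab
  proper := ⟨0, EReal.coe_lt_top _⟩

theorem Gamma0.sub_dual {h : E → EReal} (hh : Gamma0 h) (u : StrongDual ℝ E) :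
    Gamma0 (fun x => h x - ((u x : ℝ) : EReal)) := by
  have h1 : Gamma0 (fun x => (((-u) x : ℝ) : EReal)) :=
    Gamma0.of_real ((-u).toLinearMap.convexOn convex_univ) (-u).continuous
  obtain ⟨x, hx⟩ := hh.proper
  have := hh.add h1 ⟨x, hx, EReal.coe_lt_top _⟩
  simpa [sub_eq_add_neg] using this

theorem Gamma0.comp_clm {F : Type*} [NormedAddCommGroup F] [NormedSpace ℝ F] {h : F → EReal}
    (hh : Gamma0 h) (L : E →L[ℝ] F) (hd : ∃ x, L x ∈ dom h) : Gamma0 (fun x => h (L x)) where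
  ne_bot x := hh.ne_bot _
  lsc := fun x => (hh.lsc (L x)).comp L.continuous.continuousAt
  convex x y a b ha hb hab := by
    rw [map_add, map_smul, map_smul]; exact hh.convex _ _ a b ha hb hab
  proper := hd

open Classical in
/-- The convex-analytic indicator function of a set. -/
noncomputable def indicatorFn (C : Set E) (x : E) : EReal := if x ∈ C then 0 else ⊤

theorem indicatorFn_of_mem {C : Set E} {x : E} (hx : x ∈ C) : indicatorFn C x = 0 := if_pos hx

theorem indicatorFn_of_notMem {C : Set E} {x : E} (hx : x ∉ C) : indicatorFn C x = ⊤ := if_neg hx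

theorem dom_indicatorFn (C : Set E) : dom (indicatorFn C) = C := by
  ext x
  by_cases hx : x ∈ C
  · simp [dom, indicatorFn_of_mem hx, hx]
  · simp [dom, indicatorFn_of_notMem hx, hx]

theorem gamma0_indicatorFn {C : Set E} (hC : Convex ℝ C) (hcl : IsClosed C) (hne : C.Nonempty) :
    Gamma0 (indicatorFn C) where
  ne_bot x := by
    by_cases hx : x ∈ C
    · simp [indicatorFn_of_mem hx]
    · simp [indicatorFn_of_notMem hx]
  lsc := by
    refine lowerSemicontinuous_iff_isClosed_preimage.2 fun y => ?_
    rcases eq_or_ne y ⊤ with rfl | hy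
    · simp
    by_cases h0 : 0 ≤ y
    · have : indicatorFn C ⁻¹' Set.Iic y = C := by
        ext x
        by_cases hx : x ∈ C
        · simp [indicatorFn_of_mem hx, hx, h0]
        · simp [indicatorFn_of_notMem hx, hx, hy]
      rwa [this]
    · have : indicatorFn C ⁻¹' Set.Iic y = ∅ := by
        ext x
        by_cases hx : x ∈ C
        · simpa [indicatorFn_of_mem hx] using h0
        · simp [indicatorFn_of_notMem hx, hy]
      rw [this]; exact isClosed_empty
  convex x y a b ha hb hab := by
    by_cases hx : x ∈ C
    · by_cases hy : y ∈ C
      · simp [indicatorFn_of_mem hx, indicatorFn_of_mem hy,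
          indicatorFn_of_mem (hC hx hy ha.le hb.le hab)]
      · rw [indicatorFn_of_mem hx, indicatorFn_of_notMem hy, EReal.coe_mul_top_of_pos hb]; simp
    · rw [indicatorFn_of_notMem hx, EReal.coe_mul_top_of_pos ha]
      by_cases hy : y ∈ C
      · simp [indicatorFn_of_mem hy]
      · simp [indicatorFn_of_notMem hy, EReal.coe_mul_top_of_pos hb]
  proper := by rwa [dom_indicatorFn]

/-- A function in `Γ₀` on a Banach space is bounded above near interior points of its domain. -/
theorem Gamma0.exists_bound [CompleteSpace E] {h : E → EReal} (hh : Gamma0 h) {p : E}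
    (hp : p ∈ intDom h) : ∃ K r : ℝ, 0 < r ∧ ∀ d : E, ‖d‖ < r → h (p + d) ≤ K := by
  -- Baire category. Convexity on a segment from `p` shows that each `d` lies in `D n` for all large
  -- `n`, so some `D n` has interior. The condition on `-d` makes it possible to average two
  -- opposite points and recentre at `p`.
  let D : ℕ → Set E := fun n =>
    {d | h (p + (1 / ((n : ℝ) + 1)) • d) ≤ ((n : ℝ) : EReal)} ∩
      {d | h (p + (1 / ((n : ℝ) + 1)) • (-d)) ≤ ((n : ℝ) : EReal)}
  have hclosed : ∀ n, IsClosed (D n) := fun n => by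
    refine IsClosed.inter ?_ ?_
    · exact (hh.isClosed_le ((n : ℝ) : EReal)).preimage
        (f := fun d : E => p + (1 / ((n : ℝ) + 1)) • d)
        (by fun_prop)
    · exact (hh.isClosed_le ((n : ℝ) : EReal)).preimage
        (f := fun d : E => p + (1 / ((n : ℝ) + 1)) • (-d)) (by fun_prop)
  have hev : ∀ d : E, ∀ᶠ n : ℕ in atTop,
      h (p + (1 / ((n : ℝ) + 1)) • d) ≤ ((n : ℝ) : EReal) := fun d => by
    have hlim : Tendsto (fun n : ℕ => p + (1 / ((n : ℝ) + 1)) • d) atTop (𝓝 p) := by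
      simpa using tendsto_const_nhds.add
        ((tendsto_one_div_add_atTop_nhds_zero_nat (𝕜 := ℝ)).smul_const d)
    obtain ⟨N, hN⟩ := eventually_atTop.1 (hlim.eventually (mem_interior_iff_mem_nhds.1 hp))
    set q := p + (1 / ((N : ℝ) + 1)) • d with hq
    have hqd : q ∈ dom h := hN N le_rfl
    have hpd : p ∈ dom h := intDom_subset_dom h hp
    filter_upwards [eventually_ge_atTop N,
      eventually_ge_atTop ⌈|(h p).toReal| + |(h q).toReal|⌉₊] with n hn hn2
    have hN1 : (0 : ℝ) < (N : ℝ) + 1 := by positivity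
    have hn1 : (0 : ℝ) < (n : ℝ) + 1 := by positivity
    have hNn : (N : ℝ) ≤ n := by exact_mod_cast hn
    set t : ℝ := ((N : ℝ) + 1) / ((n : ℝ) + 1) with ht
    have ht0 : 0 ≤ t := by positivity
    have ht1 : t ≤ 1 := by rw [ht, div_le_one hn1]; linarith
    have heq : p + (1 / ((n : ℝ) + 1)) • d = (1 - t) • p + t • q := by
      rw [hq, smul_add, smul_smul, ← add_assoc, ← add_smul, ht]
      have : ((N : ℝ) + 1) / ((n : ℝ) + 1) * (1 / ((N : ℝ) + 1)) = 1 / ((n : ℝ) + 1) := by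
        field_simp
      rw [this]; simp
    rw [heq]
    refine (hh.le_combo (hh.coe_toReal hpd).ge (hh.coe_toReal hqd).ge (by linarith) ht0
      (by ring)).trans (EReal.coe_le_coe_iff.2 ?_)
    have h1 : (1 - t) * (h p).toReal ≤ |(h p).toReal| := by
      calc (1 - t) * (h p).toReal ≤ (1 - t) * |(h p).toReal| :=
            mul_le_mul_of_nonneg_left (le_abs_self _) (by linarith)
        _ ≤ 1 * |(h p).toReal| := mul_le_mul_of_nonneg_right (by linarith) (abs_nonneg _)
        _ = _ := one_mul _
    have h2 : t * (h q).toReal ≤ |(h q).toReal| := by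
      calc t * (h q).toReal ≤ t * |(h q).toReal| :=
            mul_le_mul_of_nonneg_left (le_abs_self _) ht0
        _ ≤ 1 * |(h q).toReal| := mul_le_mul_of_nonneg_right ht1 (abs_nonneg _)
        _ = _ := one_mul _
    have h3 := Nat.ceil_le.1 hn2
    linarith
  have hU : ⋃ n, D n = Set.univ := by
    refine Set.eq_univ_of_forall fun d => ?_
    obtain ⟨n, h1, h2⟩ := ((hev d).and (hev (-d))).exists
    exact Set.mem_iUnion.2 ⟨n, h1, h2⟩
  obtain ⟨n, d₀, hd₀⟩ := nonempty_interior_of_iUnion_of_closed hclosed hU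
  obtain ⟨r, hr, hball⟩ := Metric.isOpen_iff.1 isOpen_interior d₀ hd₀
  have hball' : ∀ e : E, ‖e‖ < r → d₀ + e ∈ D n := fun e he =>
    interior_subset (hball (by simpa [dist_eq_norm] using he))
  have hn1 : (0 : ℝ) < (n : ℝ) + 1 := by positivity
  refine ⟨n, r / (n + 1), by positivity, fun d hd => ?_⟩
  set e := ((n : ℝ) + 1) • d with he
  have hen : ‖e‖ < r := by
    rw [he, norm_smul, Real.norm_of_nonneg hn1.le, mul_comm]
    exact (lt_div_iff₀ hn1).1 hd
  have h1 := (hball' e hen).1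
  have h2 := (hball' (-e) (by rwa [norm_neg])).2
  have heq : p + d = (1 / 2 : ℝ) • (p + (1 / ((n : ℝ) + 1)) • (d₀ + e)) +
      (1 / 2 : ℝ) • (p + (1 / ((n : ℝ) + 1)) • (-(d₀ + -e))) := by
    have : d = (1 / ((n : ℝ) + 1)) • e := by
      rw [he, smul_smul, one_div, inv_mul_cancel₀ hn1.ne', one_smul]
    rw [this]; module
  rw [heq]
  refine (hh.le_combo h1 h2 (by norm_num) (by norm_num) (by norm_num)).trans
    (EReal.coe_le_coe_iff.2 (by linarith))

/-- A sandwich theorem: if `0 ≤ F + G` with `F` bounded above near a point of `dom G`, then an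
affine function fits between `-G` and `F`. -/
theorem exists_affine_between {F G : E → EReal} (hF : Gamma0 F) (hG : Gamma0 G) {p : E} {K r : ℝ}
    (hr : 0 < r) (hK : ∀ d : E, ‖d‖ < r → F (p + d) ≤ K) (hp : p ∈ dom G)
    (hFG : ∀ x ∈ dom F ∩ dom G, 0 ≤ (F x).toReal + (G x).toReal) :
    ∃ (u : StrongDual ℝ E) (c : ℝ), (∀ x ∈ dom F, u x + c ≤ (F x).toReal) ∧
      ∀ x ∈ dom G, -(u x + c) ≤ (G x).toReal := by
  -- Separate the interior of the epigraph of `F` from the hypograph of `-G`.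
  let A : Set (E × ℝ) := {q | F q.1 ≤ (q.2 : EReal)}
  let B : Set (E × ℝ) := {q | G q.1 ≤ ((-q.2 : ℝ) : EReal)}
  have hA : Convex ℝ A := by
    intro q hq q' hq' a b ha hb hab
    exact hF.le_combo hq hq' ha hb hab
  have hB : Convex ℝ B := by
    intro q hq q' hq' a b ha hb hab
    have := hG.le_combo hq hq' ha hb hab
    change G (a • q.1 + b • q'.1) ≤ ((-(a * q.2 + b * q'.2) : ℝ) : EReal)
    exact this.trans_eq (by congr 1; ring)
  have hAmem : ∀ x ∈ dom F, ∀ t, (F x).toReal ≤ t → (x, t) ∈ A := fun x hx t ht => by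
    change F x ≤ (t : EReal)
    rw [← hF.coe_toReal hx]; exact_mod_cast ht
  have hBmem : ∀ x ∈ dom G, (x, -(G x).toReal) ∈ B := fun x hx => by
    change G x ≤ _
    simp only [neg_neg]
    rw [hG.coe_toReal hx]
  have hint : (p, K + 1) ∈ interior A := by
    refine mem_interior.2 ⟨Metric.ball p r ×ˢ Set.Ioi K, ?_, Metric.isOpen_ball.prod isOpen_Ioi,
      ⟨Metric.mem_ball_self hr, by simp⟩⟩
    rintro ⟨x, t⟩ ⟨hx, ht⟩
    have := hK (x - p) (by simpa [dist_eq_norm] using hx)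
    rw [add_sub_cancel] at this
    exact this.trans (EReal.coe_le_coe_iff.2 (le_of_lt ht))
  have hdisj : Disjoint (interior A) B := by
    rw [Set.disjoint_left]
    rintro ⟨x, t⟩ hxA hxB
    have hopen : ∀ᶠ e in 𝓝[>] (0 : ℝ), (x, t - e) ∈ interior A := by
      have hc : Tendsto (fun e : ℝ => (x, t - e)) (𝓝[>] 0) (𝓝 (x, t)) := by
        have : Continuous fun e : ℝ => (x, t - e) := by fun_prop
        simpa using (this.tendsto 0).mono_left nhdsWithin_le_nhds
      exact hc.eventually (isOpen_interior.mem_nhds hxA)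
    obtain ⟨e, he, he0⟩ := (hopen.and self_mem_nhdsWithin).exists
    have h1 : F x ≤ ((t - e : ℝ) : EReal) := (interior_subset he : (x, t - e) ∈ A)
    have h2 : G x ≤ ((-t : ℝ) : EReal) := hxB
    have h3 := hF.toReal_le h1
    have h4 := hG.toReal_le h2
    have h5 := hFG x ⟨mem_dom_of_le_coe h1, mem_dom_of_le_coe h2⟩
    have : 0 < e := he0
    linarith
  obtain ⟨f, c, hf0, hfA, hfB⟩ := geometric_hahn_banach_of_nonempty_interior hA hB hdisj
    ⟨_, hint⟩ ⟨_, hBmem p hp⟩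
  set w : StrongDual ℝ E := f.comp (ContinuousLinearMap.inl ℝ E ℝ) with hw
  set s : ℝ := f (0, 1) with hs
  have hf : ∀ x t, f (x, t) = w x + s * t := fun x t => by
    have : (x, t) = ContinuousLinearMap.inl ℝ E ℝ x + t • ((0 : E), (1 : ℝ)) := by simp
    rw [this, map_add, map_smul, hw, hs, smul_eq_mul, mul_comm]; rfl
  have hpd : ∀ d : E, ‖d‖ < r → p + d ∈ dom F := fun d hd => mem_dom_of_le_coe (hK d hd)
  have hpK := hK 0 (by simpa using hr)
  rw [add_zero] at hpK
  have hpF : p ∈ dom F := mem_dom_of_le_coe hpK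
  have hs_nonpos : s ≤ 0 := by
    by_contra hspos
    push Not at hspos
    -- The height is chosen so that, if `s > 0`, the functional is at least `c + s` there; the
    -- maximum with `K` keeps the point in the epigraph.
    have h1 := hfA _ (hAmem p hpF (max K (K + (c - w p - s * K) / s + 1)) (by
      exact (hF.toReal_le hpK).trans (le_max_left _ _)))
    rw [hf] at h1
    have h2 : s * (K + (c - w p - s * K) / s + 1) ≤
        s * max K (K + (c - w p - s * K) / s + 1) :=
      mul_le_mul_of_nonneg_left (le_max_right _ _) hspos.le
    have h3 : s * (K + (c - w p - s * K) / s + 1) = c - w p + s := by field_simp; ring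
    linarith
  -- The hyperplane is not vertical: otherwise `w ≤ 0` on a ball around the origin, since `p + d ∈
  -- dom F` for small `d` while `p ∈ dom G`, and then `w = 0`.
  have hs_ne : s ≠ 0 := by
    intro hs0
    have h1 : c ≤ w p := by
      have := hfB _ (hBmem p hp)
      rwa [hf, hs0, zero_mul, add_zero] at this
    have h2 : ∀ d : E, ‖d‖ < r → w d ≤ 0 := fun d hd => by
      have := hfA _ (hAmem (p + d) (hpd d hd) _ le_rfl)
      rw [hf, hs0, zero_mul, add_zero, map_add] at this
      linarith
    have h3 : w = 0 := by
      ext d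
      have hpos : 0 < r / (2 * (‖d‖ + 1)) := by positivity
      have hnorm : ∀ d' : E, ‖d'‖ = ‖d‖ → ‖(r / (2 * (‖d‖ + 1))) • d'‖ < r := fun d' hd' => by
        rw [norm_smul, Real.norm_of_nonneg hpos.le, hd', div_mul_eq_mul_div,
          div_lt_iff₀ (by positivity)]
        nlinarith [norm_nonneg d]
      have h4 := h2 _ (hnorm d rfl)
      have h5 := h2 _ (hnorm (-d) (norm_neg d))
      rw [map_smul, smul_eq_mul] at h4 h5
      rw [map_neg] at h5
      have h6 : w d ≤ 0 := nonpos_of_mul_nonpos_right h4 hpos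
      have h7 : -w d ≤ 0 := nonpos_of_mul_nonpos_right h5 hpos
      simp only [zero_apply]
      linarith
    apply hf0
    ext <;> simp [hf, h3, hs0]
  have hs_neg : s < 0 := lt_of_le_of_ne hs_nonpos hs_ne
  refine ⟨(-s)⁻¹ • w, -((-s)⁻¹ * c), fun x hx => ?_, fun x hx => ?_⟩
  · have h1 := hfA _ (hAmem x hx _ le_rfl)
    rw [hf] at h1
    have : (-s)⁻¹ * (w x - c) ≤ (-s)⁻¹ * (-s * (F x).toReal) :=
      mul_le_mul_of_nonneg_left (by linarith) (inv_nonneg.2 (by linarith))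
    rw [inv_mul_cancel_left₀ (by linarith)] at this
    simp only [smul_apply, smul_eq_mul]
    linarith
  · have h1 := hfB _ (hBmem x hx)
    rw [hf] at h1
    have : (-s)⁻¹ * (c - w x) ≤ (-s)⁻¹ * (-s * (G x).toReal) :=
      mul_le_mul_of_nonneg_left (by linarith) (inv_nonneg.2 (by linarith))
    rw [inv_mul_cancel_left₀ (by linarith)] at this
    simp only [smul_apply, smul_eq_mul]
    linarith

end Convex

/-! ### Legendre functions, subgradients and the proximity operator -/

section Legendre

variable {E : Type*} [NormedAddCommGroup E] [NormedSpace ℝ E]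

theorem HasGateauxGrad.unique {h : E → EReal} {u v : StrongDual ℝ E} {x : E}
    (hu : HasGateauxGrad h u x) (hv : HasGateauxGrad h v x) : u = v := by
  ext d
  exact (hu d).unique (hv d)

theorem HasGateauxGrad.grad_eq {h : E → EReal} {u : StrongDual ℝ E} {x : E}
    (hu : HasGateauxGrad h u x) : grad h x = u := by
  have hex : ∃ u : StrongDual ℝ E, HasGateauxGrad h u x := ⟨u, hu⟩
  rw [grad, dif_pos hex]
  exact hex.choose_spec.unique hu

theorem GateauxDiffOnIntDom.hasGrad {h : E → EReal} (hh : GateauxDiffOnIntDom h) {x : E}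
    (hx : x ∈ intDom h) : HasGateauxGrad h (grad h x) x := by
  obtain ⟨u, hu⟩ := hh x hx
  rwa [hu.grad_eq]

theorem norm_inclusionInDoubleDual (x : E) : ‖NormedSpace.inclusionInDoubleDual ℝ E x‖ = ‖x‖ :=
  (NormedSpace.inclusionInDoubleDualLi ℝ (E := E)).norm_map x

theorem Gamma0.mem_dom_of_mem_subdiff {h : E → EReal} (hh : Gamma0 h) {x : E}
    {u : StrongDual ℝ E} (hu : u ∈ subdiff h x) : x ∈ dom h := by
  obtain ⟨y, hy⟩ := hh.proper
  by_contra hx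
  have htop : h x = ⊤ := not_lt_top_iff.1 hx
  have h1 := hu y
  rw [htop, EReal.coe_add_top, top_le_iff] at h1
  exact hy.ne h1

theorem Gamma0.mem_subdiff_iff {h : E → EReal} (hh : Gamma0 h) {x : E} (hx : x ∈ dom h)
    {u : StrongDual ℝ E} :
    u ∈ subdiff h x ↔ ∀ y ∈ dom h, u (y - x) + (h x).toReal ≤ (h y).toReal := by
  constructor
  · intro hu y hy
    have h1 := hu y
    rw [← hh.coe_toReal hx, ← hh.coe_toReal hy] at h1
    exact_mod_cast h1
  · intro hu y
    by_cases hy : y ∈ dom h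
    · rw [← hh.coe_toReal hx, ← hh.coe_toReal hy]
      exact_mod_cast hu y hy
    · have : h y = ⊤ := not_lt_top_iff.1 hy
      rw [this]; exact le_top

theorem Gamma0.le_of_mem_subdiff {h : E → EReal} (hh : Gamma0 h) {x y : E}
    {u : StrongDual ℝ E} (hu : u ∈ subdiff h x) (hy : y ∈ dom h) :
    u (y - x) + (h x).toReal ≤ (h y).toReal :=
  (hh.mem_subdiff_iff (hh.mem_dom_of_mem_subdiff hu)).1 hu y hy

theorem HasGateauxGrad.mem_subdiff {h : E → EReal} (hh : Gamma0 h) {x : E} (hx : x ∈ dom h)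
    {u : StrongDual ℝ E} (hu : HasGateauxGrad h u x) : u ∈ subdiff h x := by
  refine (hh.mem_subdiff_iff hx).2 fun y hy => ?_
  have hlim := (hu (y - x)).tendsto_slope_zero_right
  have : u (y - x) ≤ (h y).toReal - (h x).toReal := by
    refine le_of_tendsto hlim ?_
    filter_upwards [Ioo_mem_nhdsGT (zero_lt_one' ℝ)] with t ht
    have h1 := hh.toReal_combo_le hx hy (a := 1 - t) (b := t) (by linarith [ht.2]) ht.1.le (by ring)
    have h2 : (1 - t) • x + t • y = x + t • (y - x) := by module
    rw [h2] at h1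
    rw [smul_eq_mul, inv_mul_le_iff₀ ht.1]
    linarith
  linarith

theorem GateauxDiffOnIntDom.grad_mem_subdiff {h : E → EReal} (hg : GateauxDiffOnIntDom h)
    (hh : Gamma0 h) {x : E} (hx : x ∈ intDom h) : grad h x ∈ subdiff h x :=
  (hg.hasGrad hx).mem_subdiff hh (intDom_subset_dom h hx)

/-- At a point of `dom f` outside its interior, a nonzero normal functional could be added to a
subgradient, contradicting single-valuedness. -/
theorem IsLegendre.domSubdiff_subset {f : E → EReal} (hf : IsLegendre f) {x : E}
    {u : StrongDual ℝ E} (hu : u ∈ subdiff f x) : x ∈ intDom f := by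
  by_contra hx
  obtain ⟨v, hv0, hv⟩ := geometric_hahn_banach_of_nonempty_interior_point
    hf.gamma0.convex_dom hx hf.intDom_nonempty
  have hxd := hf.gamma0.mem_dom_of_mem_subdiff hu
  have h1 : u + v ∈ subdiff f x := (hf.gamma0.mem_subdiff_iff hxd).2 fun y hy => by
    have h2 := hf.gamma0.le_of_mem_subdiff hu hy
    have h3 := hv y hy
    rw [add_apply, map_sub v]
    linarith
  exact hv0 (by simpa using hf.subdiff_subsingleton x h1 hu)

theorem IsLegendre.grad_mem_subdiff {f : E → EReal} (hf : IsLegendre f) {x : E}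
    (hx : x ∈ intDom f) : grad f x ∈ subdiff f x := hf.gateaux.grad_mem_subdiff hf.gamma0 hx

theorem IsLegendre.grad_eq {f : E → EReal} (hf : IsLegendre f) {x : E}
    {u : StrongDual ℝ E} (hu : u ∈ subdiff f x) : grad f x = u :=
  hf.subdiff_subsingleton x (hf.grad_mem_subdiff (hf.domSubdiff_subset hu)) hu

theorem IsLegendre.strict {f : E → EReal} (hf : IsLegendre f) : StrictlyConvexOn f (intDom f) :=
  hf.strictlyConvex _ hf.gamma0.convex_dom.interior fun _ hx => ⟨_, hf.grad_mem_subdiff hx⟩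

theorem dom_sub_dual (h : E → EReal) (v : StrongDual ℝ E) :
    dom (fun x => h x - ((v x : ℝ) : EReal)) = dom h := by
  ext x
  change h x - ((v x : ℝ) : EReal) < ⊤ ↔ h x < ⊤
  induction h x with
  | bot => simp
  | top => simp
  | coe r => exact iff_of_true (EReal.coe_lt_top (r - v x)) (EReal.coe_lt_top r)

theorem Gamma0.toReal_sub_dual {h : E → EReal} (hh : Gamma0 h) (v : StrongDual ℝ E) {x : E}
    (hx : x ∈ dom h) : (h x - ((v x : ℝ) : EReal)).toReal = (h x).toReal - v x := by
  rw [← hh.coe_toReal hx, ← EReal.coe_sub, EReal.toReal_coe, EReal.toReal_coe]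

theorem Gamma0.sub_dual_le_iff {h : E → EReal} (hh : Gamma0 h) (v : StrongDual ℝ E) {x : E}
    {c : ℝ} : h x - ((v x : ℝ) : EReal) ≤ c ↔ x ∈ dom h ∧ (h x).toReal - v x ≤ c := by
  constructor
  · intro hx
    have hxd : x ∈ dom h := by
      have := mem_dom_of_le_coe (h := fun x => h x - ((v x : ℝ) : EReal)) hx
      rwa [dom_sub_dual] at this
    refine ⟨hxd, ?_⟩
    rw [← hh.toReal_sub_dual v hxd]
    exact (hh.sub_dual v).toReal_le hx
  · rintro ⟨hxd, hx⟩
    rw [← hh.coe_toReal hxd]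
    exact_mod_cast hx

theorem Gamma0.add_mem_subdiff {h : E → EReal} (hh : Gamma0 h) {u v : StrongDual ℝ E} {x : E}
    (hu : u ∈ subdiff (fun x => h x - ((v x : ℝ) : EReal)) x) : u + v ∈ subdiff h x := by
  have hxd : x ∈ dom h := by
    have := (hh.sub_dual v).mem_dom_of_mem_subdiff hu
    rwa [dom_sub_dual] at this
  refine (hh.mem_subdiff_iff hxd).2 fun y hy => ?_
  have h1 := (hh.sub_dual v).le_of_mem_subdiff hu (y := y) (by rwa [dom_sub_dual])
  rw [hh.toReal_sub_dual v hxd, hh.toReal_sub_dual v hy] at h1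
  rw [add_apply, map_sub v]
  linarith

/-- A quantitative variational principle: perturbing by a multiple of the norm produces a point
at which there is a small subgradient. -/
theorem Gamma0.exists_small_subgradient (hE : IsReflexive E) {h : E → EReal} (hh : Gamma0 h)
    {m : ℝ} (hm : ∀ x ∈ dom h, m ≤ (h x).toReal) (y : E) {c : ℝ} (hc : 0 < c) :
    ∃ z ∈ dom h, ∃ u ∈ subdiff h z, ‖u‖ ≤ c ∧ u (z - y) ≤ -(c * ‖z - y‖) ∧
      ∀ x ∈ dom h, (h z).toReal + c * ‖z - y‖ ≤ (h x).toReal + c * ‖x - y‖ := by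
  have hconv : ∀ μ : ℝ, Gamma0 (fun x : E => ((c * ‖x - y‖ - μ : ℝ) : EReal)) := fun μ => by
    refine Gamma0.of_real ⟨convex_univ, fun x _ x' _ a b ha hb hab => ?_⟩ (by fun_prop)
    have h1 : a • x + b • x' - y = a • (x - y) + b • (x' - y) := by
      have : y = (a + b) • y := by rw [hab, one_smul]
      nth_rewrite 1 [this]
      module
    have h2 : ‖a • x + b • x' - y‖ ≤ a * ‖x - y‖ + b * ‖x' - y‖ := by
      rw [h1]
      refine (norm_add_le _ _).trans_eq ?_
      rw [norm_smul, norm_smul, Real.norm_of_nonneg ha, Real.norm_of_nonneg hb]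
    have h3 := mul_le_mul_of_nonneg_left h2 hc.le
    have h4 : μ = (a + b) * μ := by rw [hab, one_mul]
    simp only [smul_eq_mul]
    linarith
  have hdomN : ∀ μ : ℝ, dom (fun x : E => ((c * ‖x - y‖ - μ : ℝ) : EReal)) = Set.univ :=
    fun μ => Set.eq_univ_of_forall fun x => EReal.coe_lt_top _
  have hsum := hh.add (hconv 0) (by rw [hdomN, Set.inter_univ]; exact hh.proper)
  have hdsum : dom (fun x => h x + ((c * ‖x - y‖ - 0 : ℝ) : EReal)) = dom h := by
    rw [dom_add hh.ne_bot (hconv 0).ne_bot, hdomN, Set.inter_univ]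
  have hval : ∀ x ∈ dom h, h x + ((c * ‖x - y‖ - 0 : ℝ) : EReal) =
      (((h x).toReal + c * ‖x - y‖ : ℝ) : EReal) := fun x hx => by
    nth_rewrite 1 [← hh.coe_toReal hx]
    rw [sub_zero]; rfl
  -- The lower bound `m` makes `h + c‖· - y‖` coercive.
  obtain ⟨z, hz, hmin⟩ := hsum.exists_forall_le hE fun b => by
    refine (Metric.isBounded_closedBall (x := y) (r := (b - m) / c)).subset fun x hx => ?_
    have hxd : x ∈ dom h := by rw [← hdsum]; exact mem_dom_of_le_coe hx
    have hx' : h x + ((c * ‖x - y‖ - 0 : ℝ) : EReal) ≤ b := hx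
    rw [hval x hxd, EReal.coe_le_coe_iff] at hx'
    rw [mem_closedBall_iff_norm, le_div_iff₀ hc]
    linarith [hm x hxd]
  rw [hdsum] at hz
  have hmin' : ∀ x ∈ dom h, (h z).toReal + c * ‖z - y‖ ≤ (h x).toReal + c * ‖x - y‖ := by
    intro x hx
    have := hmin x
    rwa [hval x hx, hval z hz, EReal.coe_le_coe_iff] at this
  -- Sandwich between `h` and the cone `c‖· - y‖` minus the minimal value. The slope `w` is bounded
  -- by the Lipschitz constant `c` of the cone, and evaluating at the apex `y` gives the alignment
  -- `u (z - y) ≤ -(c * ‖z - y‖)` for `u = -w`.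
  obtain ⟨w, c₀, hw1, hw2⟩ := exists_affine_between (hconv ((h z).toReal + c * ‖z - y‖)) hh
    (p := z) (K := c * (‖z - y‖ + 1)  - ((h z).toReal + c * ‖z - y‖)) one_pos (fun d hd => by
      refine EReal.coe_le_coe_iff.2 ?_
      have : ‖z + d - y‖ ≤ ‖z - y‖ + 1 := by
        have := norm_add_le (z - y) d
        rw [show z + d - y = z - y + d by abel]
        linarith
      have := mul_le_mul_of_nonneg_left this hc.le
      linarith) hz (fun x hx => by
      rw [EReal.toReal_coe]
      linarith [hmin' x hx.2])
  simp only [hdomN, Set.mem_univ, true_imp_iff, EReal.toReal_coe] at hw1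
  have hz1 := hw1 z
  have hz2 := hw2 z hz
  have hslope : ∀ x, w (x - z) ≤ c * ‖x - y‖ - c * ‖z - y‖ := fun x => by
    rw [map_sub]; linarith [hw1 x]
  refine ⟨z, hz, -w, (hh.mem_subdiff_iff hz).2 fun x hx => ?_, ?_, ?_, hmin'⟩
  · rw [neg_apply, map_sub]; linarith [hw2 x hx]
  · have hup : ∀ d, w d ≤ c * ‖d‖ := fun d => by
      have h1 := hslope (z + d)
      rw [add_sub_cancel_left] at h1
      have h2 : ‖z + d - y‖ ≤ ‖z - y‖ + ‖d‖ := by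
        rw [show z + d - y = z - y + d by abel]; exact norm_add_le _ _
      have := mul_le_mul_of_nonneg_left h2 hc.le
      linarith
    refine ContinuousLinearMap.opNorm_le_bound _ hc.le fun d => ?_
    rw [neg_apply, norm_neg]
    refine abs_le.2 ⟨?_, hup d⟩
    have := hup (-d)
    rw [map_neg, norm_neg] at this
    linarith
  · have := hslope y
    rw [sub_self, norm_zero, mul_zero] at this
    have h2 : (-w) (z - y) = w (y - z) := by rw [neg_apply, ← map_neg, neg_sub]
    rw [h2]; linarith

theorem Gamma0.le_conj {h : E → EReal} (hh : Gamma0 h) (v : StrongDual ℝ E) {x : E}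
    (hx : x ∈ dom h) : ((v x - (h x).toReal : ℝ) : EReal) ≤ conj h v := by
  refine le_trans (le_of_eq ?_) (le_iSup (fun x : E => ((v x : ℝ) : EReal) - h x) x)
  rw [EReal.coe_sub, hh.coe_toReal hx]

theorem Gamma0.conj_le_iff {h : E → EReal} (hh : Gamma0 h) {v : StrongDual ℝ E} {c : EReal} :
    conj h v ≤ c ↔ ∀ x ∈ dom h, ((v x - (h x).toReal : ℝ) : EReal) ≤ c := by
  refine ⟨fun hc x hx => (hh.le_conj v hx).trans hc, fun hc => iSup_le fun x => ?_⟩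
  by_cases hx : x ∈ dom h
  · have := hc x hx
    rwa [EReal.coe_sub, hh.coe_toReal hx] at this
  · have : h x = ⊤ := not_lt_top_iff.1 hx
    rw [this]; simp

theorem Gamma0.conj_eq {h : E → EReal} (hh : Gamma0 h) {v : StrongDual ℝ E} {x : E}
    (hv : v ∈ subdiff h x) : conj h v = ((v x - (h x).toReal : ℝ) : EReal) := by
  refine le_antisymm (hh.conj_le_iff.2 fun y hy => EReal.coe_le_coe_iff.2 ?_)
    (hh.le_conj v (hh.mem_dom_of_mem_subdiff hv))
  have := hh.le_of_mem_subdiff hv hy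
  rw [map_sub] at this
  linarith

/-- The easy half of subgradient inversion, by Fenchel–Young; the converse, which uses reflexivity,
is `Gamma0.mem_subdiff_of_inclusion_mem`. -/
theorem Gamma0.inclusion_mem_subdiff_conj {h : E → EReal} (hh : Gamma0 h) {v : StrongDual ℝ E}
    {x : E} (hv : v ∈ subdiff h x) :
    NormedSpace.inclusionInDoubleDual ℝ E x ∈ subdiff (conj h) v := by
  intro w
  refine le_trans (le_of_eq ?_) (hh.le_conj w (hh.mem_dom_of_mem_subdiff hv))
  rw [hh.conj_eq hv, ← EReal.coe_add, NormedSpace.dual_def, sub_apply]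
  congr 1; ring

/-- A point `y` of the sublevel set is at controlled distance from a point `z` with a subgradient
`w` of `f - u` smaller than the radius `δ` on which `∂f*` is bounded near `u`. Then `z ∈ ∂f*(u + w)`
is bounded, hence so is `y`. -/
theorem IsLegendre.isBounded_sublevel (hE : IsReflexive E) {f : E → EReal} (hf : IsLegendre f)
    {u : StrongDual ℝ E} {x : E} (hu : u ∈ subdiff f x) (c : ℝ) :
    Bornology.IsBounded {y | f y - ((u y : ℝ) : EReal) ≤ c} := by
  obtain ⟨V, hV, hbV⟩ := hf.subdiff_conj_locallyBounded u
    ⟨_, hf.gamma0.inclusion_mem_subdiff_conj hu⟩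
  obtain ⟨R, hR⟩ := hbV.exists_norm_le
  obtain ⟨δ, hδ, hball⟩ := Metric.mem_nhds_iff.1 hV
  have hmin : ∀ y ∈ dom (fun y => f y - ((u y : ℝ) : EReal)),
      (f x).toReal - u x ≤ (f y - ((u y : ℝ) : EReal)).toReal := fun y hy => by
    rw [dom_sub_dual] at hy
    rw [hf.gamma0.toReal_sub_dual u hy]
    have := hf.gamma0.le_of_mem_subdiff hu hy
    rw [map_sub] at this
    linarith
  refine (Metric.isBounded_closedBall (x := (0 : E))
    (r := R + (c - ((f x).toReal - u x)) / (δ / 2))).subset fun y hy => ?_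
  obtain ⟨z, hz, w, hw, hwn, -, hzmin⟩ := (hf.gamma0.sub_dual u).exists_small_subgradient hE hmin y
    (half_pos hδ)
  have h1 := hzmin y (mem_dom_of_le_coe hy)
  have h2 := (hf.gamma0.sub_dual u).toReal_le hy
  have h3 := hmin z hz
  rw [sub_self, norm_zero, mul_zero, add_zero] at h1
  have h4 : ‖z - y‖ ≤ (c - ((f x).toReal - u x)) / (δ / 2) := by
    rw [le_div_iff₀ (half_pos hδ)]; linarith
  have h5 : ‖z‖ ≤ R := by
    have h6 := hf.gamma0.inclusion_mem_subdiff_conj (hf.gamma0.add_mem_subdiff hw)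
    have h7 : w + u ∈ V := hball (by
      rw [mem_ball_iff_norm, add_sub_cancel_right]; linarith)
    have h8 := hR _ (Set.mem_biUnion h7 h6)
    rwa [norm_inclusionInDoubleDual] at h8
  rw [mem_closedBall_zero_iff]
  have h6 : ‖y‖ ≤ ‖z‖ + ‖z - y‖ := by
    have := norm_sub_le z (z - y)
    rwa [sub_sub_cancel] at this
  linarith

theorem isBounded_of_forall_dual_le {s : Set E}
    (hs : ∀ v : StrongDual ℝ E, ∃ C : ℝ, ∀ y ∈ s, v y ≤ C) : Bornology.IsBounded s := by
  have := banach_steinhaus (𝕜 := ℝ) (E := StrongDual ℝ E) (F := ℝ)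
    (g := fun y : s => NormedSpace.inclusionInDoubleDual ℝ E y) (fun v => by
      obtain ⟨C, hC⟩ := hs v
      obtain ⟨C', hC'⟩ := hs (-v)
      refine ⟨max C C', fun y => ?_⟩
      rw [NormedSpace.dual_def]
      refine abs_le.2 ⟨?_, (hC y y.2).trans (le_max_left _ _)⟩
      have := hC' y y.2
      rw [neg_apply] at this
      linarith [le_max_right C C'])
  obtain ⟨C, hC⟩ := this
  refine isBounded_iff_forall_norm_le.2 ⟨C, fun y hy => ?_⟩
  have h8 := hC ⟨y, hy⟩
  rwa [norm_inclusionInDoubleDual] at h8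

/-- On the sublevel set `v y = ((u+v) y - f y) + (f y - u y) ≤ f*(u+v) + c`, so every functional is
bounded above there and uniform boundedness applies. -/
theorem Cofinite.isBounded_sublevel {f : E → EReal} (hf : Gamma0 f) (hc : Cofinite f)
    (u : StrongDual ℝ E) (c : ℝ) : Bornology.IsBounded {y | f y - ((u y : ℝ) : EReal) ≤ c} := by
  refine isBounded_of_forall_dual_le fun v => ?_
  have h1 : u + v ∈ dom (conj f) := by rw [hc]; trivial
  obtain ⟨C, hC, -⟩ := EReal.lt_iff_exists_real_btwn.1 h1
  refine ⟨C + c, fun y hy => ?_⟩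
  obtain ⟨hyd, hy'⟩ := (hf.sub_dual_le_iff u).1 hy
  have h2 := EReal.coe_le_coe_iff.1 ((hf.le_conj (u + v) hyd).trans hC.le)
  rw [add_apply] at h2
  linarith

/-- Well-posedness and optimality condition of the Bregman proximity operator. -/
theorem IsLegendre.prox_eq_singleton [CompleteSpace E] (hE : IsReflexive E) {f φ : E → EReal}
    (hf : IsLegendre f) (hφ : Gamma0 φ) {p : E} (hp : p ∈ dom φ) (hp' : p ∈ intDom f)
    {u w : StrongDual ℝ E} {C : ℝ} (hw : ∀ x ∈ dom φ, w x - C ≤ (φ x).toReal)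
    (hb : ∀ c : ℝ, Bornology.IsBounded {y | f y - (((u - w) y : ℝ) : EReal) ≤ c}) :
    ∃ z ∈ intDom f, z ∈ dom φ ∧ prox f φ u = {z} ∧ u - grad f z ∈ subdiff φ z := by
  have hf0 := hf.gamma0
  have hne : (dom φ ∩ dom f).Nonempty := ⟨p, hp, intDom_subset_dom f hp'⟩
  have hsum := (hφ.add hf0 hne).sub_dual u
  have hdom : dom (fun x => φ x + f x - ((u x : ℝ) : EReal)) = dom φ ∩ dom f := by
    rw [dom_sub_dual (fun x => φ x + f x), dom_add hφ.ne_bot hf0.ne_bot]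
  have hval : ∀ x ∈ dom φ ∩ dom f, φ x + f x - ((u x : ℝ) : EReal) =
      (((φ x).toReal + (f x).toReal - u x : ℝ) : EReal) := fun x hx => by
    rw [EReal.coe_sub, EReal.coe_add, hφ.coe_toReal hx.1, hf0.coe_toReal hx.2]
  obtain ⟨z₀, hz₀, hmin₀⟩ := hsum.exists_forall_le hE fun c => by
    refine (hb (c + C)).subset fun x hx => ?_
    have hxd : x ∈ dom φ ∩ dom f := by rw [← hdom]; exact mem_dom_of_le_coe hx
    have hx' : φ x + f x - ((u x : ℝ) : EReal) ≤ c := hx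
    rw [hval x hxd, EReal.coe_le_coe_iff] at hx'
    refine (hf0.sub_dual_le_iff (u - w)).2 ⟨hxd.2, ?_⟩
    rw [sub_apply]
    linarith [hw x hxd.1]
  -- The sum rule for `∂(φ + f)`: a sandwich between `f`, which is bounded above near `p`, and `φ -
  -- u - μ` splits `u` into a subgradient `v` of `f` and `u - v` of `φ`. Existence of `v` already
  -- makes `z` interior.
  have hopt : ∀ z, z ∈ prox f φ u →
      z ∈ intDom f ∧ z ∈ dom φ ∧ u - grad f z ∈ subdiff φ z := by
    rintro z ⟨hz, hmin⟩
    have hz' : z ∈ dom φ ∩ dom f := by rw [← hdom]; exact hz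
    obtain ⟨K, r, hr, hK⟩ := hf0.exists_bound hp'
    have hG := hφ.sub_dual u
    have hmin' : ∀ x ∈ dom φ ∩ dom f, (φ z).toReal + (f z).toReal - u z ≤
        (φ x).toReal + (f x).toReal - u x := fun x hx => by
      have := hmin x
      dsimp only at this
      rwa [hval x hx, hval z hz', EReal.coe_le_coe_iff] at this
    set μ := (φ z).toReal + (f z).toReal - u z with hμ
    have hG' : Gamma0 (fun x => φ x - ((u x : ℝ) : EReal) + ((-μ : ℝ) : EReal)) :=
      (hφ.sub_dual u).add (Gamma0.of_real (r := fun _ => -μ) (convexOn_const _ convex_univ)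
        continuous_const) ⟨p, by rwa [dom_sub_dual], EReal.coe_lt_top _⟩
    have hdG : dom (fun x => φ x - ((u x : ℝ) : EReal) + ((-μ : ℝ) : EReal)) = dom φ := by
      rw [dom_add (hφ.sub_dual u).ne_bot (fun _ => EReal.coe_ne_bot _), dom_sub_dual]
      exact Set.inter_eq_left.2 fun x _ => EReal.coe_lt_top _
    have hvG : ∀ x ∈ dom φ, (φ x - ((u x : ℝ) : EReal) + ((-μ : ℝ) : EReal)).toReal =
        (φ x).toReal - u x - μ := fun x hx => by
      rw [← hφ.coe_toReal hx, ← EReal.coe_sub, ← EReal.coe_add, EReal.toReal_coe,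
        EReal.toReal_coe, sub_eq_add_neg _ μ]
    obtain ⟨v, c₀, hv1, hv2⟩ := exists_affine_between hf0 hG' (p := p) hr hK
      (by rwa [hdG]) (fun x hx => by
        rw [hdG] at hx
        rw [hvG x hx.2]
        linarith [hmin' x ⟨hx.2, hx.1⟩])
    rw [hdG] at hv2
    have hz1 := hv1 z hz'.2
    have hz2 := hv2 z hz'.1
    rw [hvG z hz'.1] at hz2
    have hvs : v ∈ subdiff f z := (hf0.mem_subdiff_iff hz'.2).2 fun y hy => by
      rw [map_sub]; linarith [hv1 y hy]
    refine ⟨hf.domSubdiff_subset hvs, hz'.1, ?_⟩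
    rw [hf.grad_eq hvs]
    refine (hφ.mem_subdiff_iff hz'.1).2 fun y hy => ?_
    have := hv2 y hy
    rw [hvG y hy] at this
    rw [sub_apply, map_sub, map_sub]
    linarith
  have hz₀' : z₀ ∈ prox f φ u := ⟨hz₀, hmin₀⟩
  obtain ⟨ho1, ho2, ho3⟩ := hopt z₀ hz₀'
  refine ⟨z₀, ho1, ho2, Set.eq_singleton_iff_unique_mem.2 ⟨hz₀', fun z hz => ?_⟩, ho3⟩
  by_contra hne'
  obtain ⟨h1, h2, -⟩ := hopt z hz
  have hzd := intDom_subset_dom f h1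
  have hz₀d := intDom_subset_dom f ho1
  have h3 := hf.strict z h1 z₀ ho1 hne' (1 / 2) (1 / 2) (by norm_num) (by norm_num) (by norm_num)
  set y := (1 / 2 : ℝ) • z + (1 / 2 : ℝ) • z₀ with hy
  have hyf : y ∈ dom f := hf0.convex_dom hzd hz₀d (by norm_num) (by norm_num) (by norm_num)
  have hyφ : y ∈ dom φ := hφ.convex_dom h2 ho2 (by norm_num) (by norm_num) (by norm_num)
  rw [← hf0.coe_toReal hyf, ← hf0.coe_toReal hzd, ← hf0.coe_toReal hz₀d, ← EReal.coe_mul,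
    ← EReal.coe_mul, ← EReal.coe_add, EReal.coe_lt_coe_iff] at h3
  have h4 := hφ.toReal_combo_le h2 ho2 (a := 1 / 2) (b := 1 / 2) (by norm_num) (by norm_num)
    (by norm_num)
  have h5 := hz.2 y
  have h6 := hmin₀ y
  have h7 := hmin₀ z
  dsimp only at h5
  rw [hval y ⟨hyφ, hyf⟩, hval z ⟨h2, hzd⟩, EReal.coe_le_coe_iff] at h5
  rw [hval y ⟨hyφ, hyf⟩, hval z₀ ⟨ho2, hz₀d⟩, EReal.coe_le_coe_iff] at h6
  have h8 : u y = 1 / 2 * u z + 1 / 2 * u z₀ := by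
    rw [hy, map_add, map_smul, map_smul]; rfl
  rw [← hy] at h4
  linarith

end Legendre

/-! ### Real sequences decreasing up to summable factors -/

section RealSequences

variable {a b η : ℕ → ℝ}

theorem prod_one_add_le_exp_tsum (hη : ∀ n, 0 ≤ η n) (hs : Summable η) (n : ℕ) :
    ∏ k ∈ Finset.range n, (1 + η k) ≤ Real.exp (∑' k, η k) :=
  (Real.prod_one_add_le_exp_sum _ hη).trans
    (Real.exp_le_exp.2 (hs.sum_le_tsum _ fun k _ => hη k))

theorem one_le_prod_one_add (hη : ∀ n, 0 ≤ η n) (n : ℕ) :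
    1 ≤ ∏ k ∈ Finset.range n, (1 + η k) :=
  Finset.prod_induction _ (1 ≤ ·) (fun _ _ h h' => one_le_mul_of_one_le_of_one_le h h') le_rfl
    fun k _ => by linarith [hη k]

/-- Dividing by the partial products turns quasi-monotonicity into monotonicity; the products are at
least `1` and at most `exp (∑ η)`, so nothing is lost. -/
theorem antitone_div_prod (hη : ∀ n, 0 ≤ η n) (h : ∀ n, a (n + 1) ≤ (1 + η n) * a n) :
    Antitone fun n => a n / ∏ k ∈ Finset.range n, (1 + η k) := by
  refine antitone_nat_of_succ_le fun n => ?_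
  have hP := zero_lt_one.trans_le (one_le_prod_one_add hη n)
  have h1 : 0 < 1 + η n := by linarith [hη n]
  rw [Finset.prod_range_succ, div_le_div_iff₀ (by positivity) hP]
  nlinarith [h n]

theorem le_exp_tsum_mul (ha : ∀ n, 0 ≤ a n) (hη : ∀ n, 0 ≤ η n) (hs : Summable η)
    (h : ∀ n, a (n + 1) ≤ (1 + η n) * a n) {k m : ℕ} (hkm : k ≤ m) :
    a m ≤ Real.exp (∑' k, η k) * a k := by
  have h1 := antitone_div_prod hη h hkm
  have hPm := zero_lt_one.trans_le (one_le_prod_one_add hη m)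
  have h2 : a k / ∏ i ∈ Finset.range k, (1 + η i) ≤ a k :=
    div_le_self (ha k) (one_le_prod_one_add hη k)
  have h3 := (div_le_iff₀ hPm).1 (h1.trans h2)
  calc a m ≤ a k * ∏ i ∈ Finset.range m, (1 + η i) := h3
    _ ≤ a k * Real.exp (∑' k, η k) :=
      mul_le_mul_of_nonneg_left (prod_one_add_le_exp_tsum hη hs m) (ha k)
    _ = _ := mul_comm _ _

theorem tendsto_of_quasi_antitone (ha : ∀ n, 0 ≤ a n) (hη : ∀ n, 0 ≤ η n) (hs : Summable η)
    (h : ∀ n, a (n + 1) ≤ (1 + η n) * a n) : ∃ l, Tendsto a atTop (𝓝 l) := by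
  have hP0 := fun n => zero_lt_one.trans_le (one_le_prod_one_add hη n)
  have hPmono : Monotone fun n => ∏ k ∈ Finset.range n, (1 + η k) := by
    refine monotone_nat_of_le_succ fun n => ?_
    rw [Finset.prod_range_succ]
    exact le_mul_of_one_le_right (hP0 n).le (by linarith [hη n])
  have h1 := tendsto_atTop_ciSup hPmono ⟨Real.exp (∑' k, η k), by
    rintro _ ⟨n, rfl⟩; exact prod_one_add_le_exp_tsum hη hs n⟩
  have h2 := tendsto_atTop_ciInf (antitone_div_prod hη h) ⟨0, by
    rintro _ ⟨n, rfl⟩; exact div_nonneg (ha n) (hP0 n).le⟩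
  refine ⟨_, (h2.mul h1).congr fun n => ?_⟩
  exact div_mul_cancel₀ _ (hP0 n).ne'

/-- `b n ≤ (1 + η n) * a n - a (n + 1)`, and the right side tends to `0` because `a` converges. -/
theorem tendsto_zero_of_quasi_antitone (ha : ∀ n, 0 ≤ a n) (hb : ∀ n, 0 ≤ b n)
    (hη : ∀ n, 0 ≤ η n) (hs : Summable η)
    (h : ∀ n, a (n + 1) ≤ (1 + η n) * (a n - b n)) : Tendsto b atTop (𝓝 0) := by
  obtain ⟨l, hl⟩ := tendsto_of_quasi_antitone ha hη hs fun n => (h n).trans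
    (mul_le_mul_of_nonneg_left (by linarith [hb n]) (by linarith [hη n]))
  have h1 : Tendsto (fun n => (1 + η n) * a n - a (n + 1)) atTop (𝓝 ((1 + 0) * l - l)) :=
    ((tendsto_const_nhds.add hs.tendsto_atTop_zero).mul hl).sub
      (hl.comp (tendsto_add_atTop_nat 1))
  rw [add_zero, one_mul, sub_self] at h1
  refine squeeze_zero hb (fun n => ?_) h1
  nlinarith [h n, mul_nonneg (hη n) (hb n)]

end RealSequences

/-! ### Real-valued Bregman distances and affine minorants -/

section Bregman

variable {E : Type*} [NormedAddCommGroup E] [NormedSpace ℝ E]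

/-- The Bregman distance as a real number, meaningful when it is finite. -/
noncomputable def bregmanReal (h : E → EReal) (x y : E) : ℝ :=
  (h x).toReal - (h y).toReal - grad h y (x - y)

theorem Gamma0.bregman_eq {h : E → EReal} (hh : Gamma0 h) {x y : E} (hx : x ∈ dom h)
    (hy : y ∈ intDom h) : bregman h x y = (bregmanReal h x y : EReal) := by
  rw [bregman, if_pos hy, bregmanReal, EReal.coe_sub, EReal.coe_sub, hh.coe_toReal hx,
    hh.coe_toReal (intDom_subset_dom h hy)]

theorem GateauxDiffOnIntDom.bregmanReal_nonneg {h : E → EReal} (hg : GateauxDiffOnIntDom h)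
    (hh : Gamma0 h) {x y : E} (hx : x ∈ dom h) (hy : y ∈ intDom h) : 0 ≤ bregmanReal h x y := by
  have := hh.le_of_mem_subdiff (hg.grad_mem_subdiff hh hy) hx
  rw [bregmanReal]; linarith

theorem bregmanReal_three_point (h : E → EReal) (p y z : E) :
    bregmanReal h p z =
      bregmanReal h p y - bregmanReal h z y + (grad h y - grad h z) (p - z) := by
  simp only [bregmanReal, sub_apply, map_sub]
  ring

theorem toReal_scale (c : ℝ) (h : E → EReal) (x : E) :
    (scale c h x).toReal = c * (h x).toReal := by
  rw [scale, EReal.toReal_mul, EReal.toReal_coe]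

theorem HasGateauxGrad.scale {h : E → EReal} {u : StrongDual ℝ E} {x : E}
    (hu : HasGateauxGrad h u x) (c : ℝ) : HasGateauxGrad (scale c h) (c • u) x := by
  intro v
  have h1 : HasDerivAt (fun t : ℝ => c * (h (x + t • v)).toReal) (c * u v) 0 :=
    HasDerivAt.const_mul c (hu v)
  simp only [HasLineDerivAt, toReal_scale]
  exact h1

theorem HasGateauxGrad.comp_clm {F : Type*} [NormedAddCommGroup F] [NormedSpace ℝ F]
    {h : F → EReal} {L : E →L[ℝ] F} {u : StrongDual ℝ F} {x : E}
    (hu : HasGateauxGrad h u (L x)) : HasGateauxGrad (fun x => h (L x)) (u.comp L) x := by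
  intro v
  have h1 : HasDerivAt (fun t : ℝ => (h (L x + t • L v)).toReal) (u (L v)) 0 := hu (L v)
  simp only [HasLineDerivAt, map_add, map_smul]
  exact h1

theorem bregmanReal_scale {h : E → EReal} (hg : GateauxDiffOnIntDom h) (c : ℝ) (x : E) {y : E}
    (hy : y ∈ intDom h) : bregmanReal (scale c h) x y = c * bregmanReal h x y := by
  rw [bregmanReal, ((hg.hasGrad hy).scale c).grad_eq, toReal_scale, toReal_scale, smul_apply,
    smul_eq_mul, bregmanReal]
  ring

theorem bregmanReal_comp_clm {F : Type*} [NormedAddCommGroup F] [NormedSpace ℝ F]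
    {h : F → EReal} (hg : GateauxDiffOnIntDom h) (L : E →L[ℝ] F) (x : E) {y : E}
    (hy : L y ∈ intDom h) :
    bregmanReal (fun x => h (L x)) x y = bregmanReal h (L x) (L y) := by
  rw [bregmanReal, (hg.hasGrad hy).comp_clm.grad_eq, bregmanReal, ContinuousLinearMap.comp_apply,
    map_sub]

theorem mem_intDom_comp_clm {F : Type*} [NormedAddCommGroup F] [NormedSpace ℝ F]
    {h : F → EReal} (L : E →L[ℝ] F) {y : E} (hy : L y ∈ intDom h) :
    y ∈ intDom (fun x => h (L x)) :=
  preimage_interior_subset_interior_preimage L.continuous hy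

theorem Dominates.bregmanReal_le {f g₁ g₂ : E → EReal} (hd : Dominates f g₁ g₂) (h₁ : Gamma0 g₁)
    (h₂ : Gamma0 g₂) (hi₁ : intDom f ⊆ intDom g₁) (hi₂ : intDom f ⊆ intDom g₂) {x y : E}
    (hx : x ∈ intDom f) (hy : y ∈ intDom f) : bregmanReal g₂ x y ≤ bregmanReal g₁ x y := by
  have := hd x (intDom_subset_dom f hx) y hy
  rwa [h₁.bregman_eq (intDom_subset_dom g₁ (hi₁ hx)) (hi₁ hy),
    h₂.bregman_eq (intDom_subset_dom g₂ (hi₂ hx)) (hi₂ hy), EReal.coe_le_coe_iff] at this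

/-- Lower semicontinuity gives `h > h p - 1` on a small ball. The sandwich theorem is applied to `h`
and the indicator of that ball minus this constant; the indicator supplies the interior point, so
`dom h` may have empty interior. -/
theorem Gamma0.exists_affine_minorant {h : E → EReal} (hh : Gamma0 h) :
    ∃ (w : StrongDual ℝ E) (C : ℝ), ∀ x ∈ dom h, w x - C ≤ (h x).toReal := by
  obtain ⟨p, hp⟩ := hh.proper
  have hlt : (((h p).toReal - 1 : ℝ) : EReal) < h p := by
    nth_rewrite 2 [← hh.coe_toReal hp]
    exact EReal.coe_lt_coe_iff.2 (by linarith)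
  obtain ⟨r, hr, hball⟩ := Metric.mem_nhds_iff.1 (hh.lsc p _ hlt)
  set C := Metric.closedBall p (r / 2) with hC
  have hF : Gamma0 (fun x => indicatorFn C x + ((-((h p).toReal - 1) : ℝ) : EReal)) :=
    (gamma0_indicatorFn (convex_closedBall p _) Metric.isClosed_closedBall
      ⟨p, Metric.mem_closedBall_self (by positivity)⟩).add
      (Gamma0.of_real (r := fun _ => -((h p).toReal - 1)) (convexOn_const _ convex_univ)
        continuous_const) ⟨p, by
          rw [dom_indicatorFn]; exact Metric.mem_closedBall_self (by positivity),
          EReal.coe_lt_top _⟩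
  have hval : ∀ x ∈ C, indicatorFn C x + ((-((h p).toReal - 1) : ℝ) : EReal) =
      ((-((h p).toReal - 1) : ℝ) : EReal) := fun x hx => by
    rw [indicatorFn_of_mem hx, zero_add]
  obtain ⟨u, c, -, hu⟩ := exists_affine_between hF hh (p := p) (K := -((h p).toReal - 1))
    (half_pos hr) (fun d hd => (hval _ (by
      rw [hC, mem_closedBall_iff_norm, add_sub_cancel_left]; exact hd.le)).le) hp
    (fun x hx => by
      have hxC : x ∈ C := by
        by_contra hxC
        have : indicatorFn C x + ((-((h p).toReal - 1) : ℝ) : EReal) ≠ ⊤ := ne_of_lt hx.1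
        rw [indicatorFn_of_notMem hxC, EReal.top_add_coe] at this
        exact this rfl
      rw [hval x hxC, EReal.toReal_coe]
      have h1 : (((h p).toReal - 1 : ℝ) : EReal) < h x := hball
        (Metric.closedBall_subset_ball (by linarith) hxC)
      rw [← hh.coe_toReal hx.2, EReal.coe_lt_coe_iff] at h1
      linarith)
  exact ⟨-u, c, fun x hx => by rw [neg_apply]; linarith [hu x hx]⟩

end Bregman

/-! ### The solution set -/

section Solutions

variable {X Y : Type*} [NormedAddCommGroup X] [NormedSpace ℝ X]
  [NormedAddCommGroup Y] [NormedSpace ℝ Y]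
  {φ : X → EReal} {ψ : Y → EReal} {L : X →L[ℝ] Y}

/-- The objective function as a real number, meaningful on its domain. -/
noncomputable def objReal (φ : X → EReal) (ψ : Y → EReal) (L : X →L[ℝ] Y) (x : X) : ℝ :=
  (φ x).toReal + (ψ (L x)).toReal

theorem obj_eq (hφ : Gamma0 φ) (hψ : Gamma0 ψ) {x : X} (hx : x ∈ dom φ) (hx' : L x ∈ dom ψ) :
    φ x + ψ (L x) = (objReal φ ψ L x : EReal) := by
  rw [objReal, EReal.coe_add, hφ.coe_toReal hx, hψ.coe_toReal hx']

theorem mem_dom_of_mem_solutions (hφ : Gamma0 φ) (hψ : Gamma0 ψ) {x : X}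
    (hx : x ∈ solutions φ ψ L) : x ∈ dom φ ∧ L x ∈ dom ψ := by
  have h1 : x ∈ dom (fun x => φ x + ψ (L x)) := hx.1
  rwa [dom_add hφ.ne_bot fun x => hψ.ne_bot (L x)] at h1

theorem objReal_le (hφ : Gamma0 φ) (hψ : Gamma0 ψ) {p x : X} (hp : p ∈ solutions φ ψ L)
    (hx : x ∈ dom φ) (hx' : L x ∈ dom ψ) : objReal φ ψ L p ≤ objReal φ ψ L x := by
  obtain ⟨h1, h2⟩ := mem_dom_of_mem_solutions hφ hψ hp
  have := hp.2 x
  dsimp only at this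
  rwa [obj_eq hφ hψ h1 h2, obj_eq hφ hψ hx hx', EReal.coe_le_coe_iff] at this

theorem gamma0_obj (hφ : Gamma0 φ) (hψ : Gamma0 ψ) (hS : (solutions φ ψ L).Nonempty) :
    Gamma0 (fun x => φ x + ψ (L x)) := by
  obtain ⟨p, hp⟩ := hS
  obtain ⟨h1, h2⟩ := mem_dom_of_mem_solutions hφ hψ hp
  exact hφ.add (hψ.comp_clm L ⟨p, h2⟩) ⟨p, h1, h2⟩

theorem solutions_eq {p : X} (hp : p ∈ solutions φ ψ L) :
    solutions φ ψ L = {x | φ x + ψ (L x) ≤ φ p + ψ (L p)} := by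
  ext x
  exact ⟨fun hx => hx.2 p, fun hx => ⟨lt_of_le_of_lt hx hp.1, fun y => le_trans hx (hp.2 y)⟩⟩

theorem convex_solutions (hφ : Gamma0 φ) (hψ : Gamma0 ψ) : Convex ℝ (solutions φ ψ L) := by
  rcases (solutions φ ψ L).eq_empty_or_nonempty with h | ⟨p, hp⟩
  · rw [h]; exact convex_empty
  · rw [solutions_eq hp]; exact (gamma0_obj hφ hψ ⟨p, hp⟩).convex_le _

theorem isClosed_solutions (hφ : Gamma0 φ) (hψ : Gamma0 ψ) : IsClosed (solutions φ ψ L) := by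
  rcases (solutions φ ψ L).eq_empty_or_nonempty with h | ⟨p, hp⟩
  · rw [h]; exact isClosed_empty
  · rw [solutions_eq hp]; exact (gamma0_obj hφ hψ ⟨p, hp⟩).isClosed_le _

end Solutions

/-! ### The forward-backward orbit and its quasi-Fejér property -/

section Iteration

variable {X Y : Type*} [NormedAddCommGroup X] [NormedSpace ℝ X]
  [NormedAddCommGroup Y] [NormedSpace ℝ Y]

/-- The standing assumptions on the problem, the metrics and the step sizes. -/
structure Setting (φ : X → EReal) (ψ : Y → EReal) (L : X →L[ℝ] Y) (f : X → EReal) (β : ℝ)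
    (η : ℕ → ℝ) (α : ℝ) (fn : ℕ → X → EReal) (ε : ℝ) (γ : ℕ → ℝ) : Prop where
  gamma0_φ : Gamma0 φ
  gamma0_ψ : Gamma0 ψ
  gateaux_ψ : GateauxDiffOnIntDom ψ
  legendre_f : IsLegendre f
  maps : ∀ x ∈ intDom f, L x ∈ intDom ψ
  β_pos : 0 < β
  dominates_ψ : Dominates f f (scale β (fun x => ψ (L x)))
  η_nonneg : ∀ n, 0 ≤ η n
  η_summable : Summable η
  α_pos : 0 < α
  legendre_fn : ∀ n, IsLegendre (fn n)
  memP : ∀ n, MemP α f (fn n)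
  dominates_succ : ∀ n, Dominates f (scale (1 + η n) (fn n)) (fn (n + 1))
  ε_pos : 0 < ε
  step : ∀ n, ε ≤ γ n ∧ γ n ≤ α * β * (1 - ε)

namespace Setting

variable {φ : X → EReal} {ψ : Y → EReal} {L : X →L[ℝ] Y} {f : X → EReal} {β : ℝ}
    {η : ℕ → ℝ} {α : ℝ} {fn : ℕ → X → EReal} {ε : ℝ} {γ : ℕ → ℝ}

theorem intDom_fn (H : Setting φ ψ L f β η α fn ε γ) (n : ℕ) : intDom (fn n) = intDom f :=
  (H.memP n).1.intDom_eq

theorem mem_intDom_fn (H : Setting φ ψ L f β η α fn ε γ) (n : ℕ) {x : X} (hx : x ∈ intDom f) :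
    x ∈ intDom (fn n) := (H.intDom_fn n).symm ▸ hx

theorem γ_pos (H : Setting φ ψ L f β η α fn ε γ) (n : ℕ) : 0 < γ n :=
  H.ε_pos.trans_le (H.step n).1

theorem bregmanReal_ψ_le (H : Setting φ ψ L f β η α fn ε γ) {x y : X} (hx : x ∈ intDom f)
    (hy : y ∈ intDom f) : β * bregmanReal ψ (L x) (L y) ≤ bregmanReal f x y := by
  have hsub : intDom f ⊆ intDom (fun x => ψ (L x)) :=
    fun z hz => mem_intDom_comp_clm L (H.maps z hz)
  have h1 := H.dominates_ψ.bregmanReal_le H.legendre_f.gamma0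
    ((H.gamma0_ψ.comp_clm L ⟨x, intDom_subset_dom ψ (H.maps x hx)⟩).scale H.β_pos) le_rfl
    (by rw [intDom_scale H.β_pos]; exact hsub) hx hy
  have h2 : bregmanReal (scale β (fun x => ψ (L x))) x y = β * bregmanReal ψ (L x) (L y) := by
    rw [← bregmanReal_comp_clm H.gateaux_ψ L x (H.maps y hy), bregmanReal,
      ((H.gateaux_ψ.hasGrad (H.maps y hy)).comp_clm.scale β).grad_eq, toReal_scale, toReal_scale,
      bregmanReal, (H.gateaux_ψ.hasGrad (H.maps y hy)).comp_clm.grad_eq, smul_apply, smul_eq_mul]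
    ring
  rwa [h2] at h1

theorem bregmanReal_f_le (H : Setting φ ψ L f β η α fn ε γ) (n : ℕ) {x y : X}
    (hx : x ∈ intDom f) (hy : y ∈ intDom f) :
    α * bregmanReal f x y ≤ bregmanReal (fn n) x y := by
  have h1 := (H.memP n).2.bregmanReal_le (H.legendre_fn n).gamma0
    (H.legendre_f.gamma0.scale H.α_pos) (H.intDom_fn n).ge
    (by rw [intDom_scale H.α_pos]) hx hy
  rwa [bregmanReal_scale H.legendre_f.gateaux α x hy] at h1

theorem bregmanReal_succ_le (H : Setting φ ψ L f β η α fn ε γ) (n : ℕ) {x y : X}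
    (hx : x ∈ intDom f) (hy : y ∈ intDom f) :
    bregmanReal (fn (n + 1)) x y ≤ (1 + η n) * bregmanReal (fn n) x y := by
  have hpos : 0 < 1 + η n := by linarith [H.η_nonneg n]
  have h1 := (H.dominates_succ n).bregmanReal_le ((H.legendre_fn n).gamma0.scale hpos)
    (H.legendre_fn (n + 1)).gamma0 (by rw [intDom_scale hpos, H.intDom_fn])
    (H.intDom_fn (n + 1)).ge hx hy
  rwa [bregmanReal_scale (H.legendre_fn n).gateaux _ x (H.mem_intDom_fn n hy)] at h1

theorem bregmanReal_fn_nonneg (H : Setting φ ψ L f β η α fn ε γ) (n : ℕ) {x y : X}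
    (hx : x ∈ intDom f) (hy : y ∈ intDom f) : 0 ≤ bregmanReal (fn n) x y :=
  (H.legendre_fn n).gateaux.bregmanReal_nonneg (H.legendre_fn n).gamma0
    (intDom_subset_dom _ (H.mem_intDom_fn n hx)) (H.mem_intDom_fn n hy)

theorem bregmanReal_ψ_nonneg (H : Setting φ ψ L f β η α fn ε γ) {x y : X}
    (hx : L x ∈ dom ψ) (hy : y ∈ intDom f) : 0 ≤ bregmanReal ψ (L x) (L y) :=
  H.gateaux_ψ.bregmanReal_nonneg H.gamma0_ψ hx (H.maps y hy)

/-- One step of the iteration is well defined. -/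
theorem exists_step [CompleteSpace X] (H : Setting φ ψ L f β η α fn ε γ) (hX : IsReflexive X)
    (hS : (solutions φ ψ L ∩ intDom f).Nonempty)
    (hdom : (∀ y ∈ intDom ψ, -((grad ψ y).comp L) ∈ dom (conj φ)) ∨ ∀ n, Cofinite (fn n))
    (n : ℕ) {x : X} (hx : x ∈ intDom f) :
    ∃ z ∈ intDom f, z ∈ dom φ ∧
      prox (fn n) (scale (γ n) φ) (grad (fn n) x - γ n • pullGrad ψ L x) = {z} ∧
      grad (fn n) x - γ n • pullGrad ψ L x - grad (fn n) z ∈ subdiff (scale (γ n) φ) z := by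
  obtain ⟨p, hpS, hpU⟩ := hS
  have hφγ := H.gamma0_φ.scale (H.γ_pos n)
  have hd := dom_scale (H.γ_pos n) φ
  have hp : p ∈ dom (scale (γ n) φ) := by
    rw [hd]; exact (mem_dom_of_mem_solutions H.gamma0_φ H.gamma0_ψ hpS).1
  have hmin : ∃ (w : StrongDual ℝ X) (C : ℝ),
      (∀ y ∈ dom (scale (γ n) φ), w y - C ≤ (scale (γ n) φ y).toReal) ∧
      ∀ c : ℝ, Bornology.IsBounded {y | fn n y -
        (((grad (fn n) x - γ n • pullGrad ψ L x - w) y : ℝ) : EReal) ≤ c} := by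
    rcases hdom with hA | hB
    · obtain ⟨C, hC, -⟩ := EReal.lt_iff_exists_real_btwn.1
        (show conj φ (-((grad ψ (L x)).comp L)) < ⊤ from hA (L x) (H.maps x hx))
      -- With this minorant of `γₙφ` the forward term cancels, and what remains is a sublevel set of
      -- `fₙ - ∇fₙ(x)`, bounded because `∇fₙ(x) ∈ ∂fₙ(x)`.
      refine ⟨-(γ n • pullGrad ψ L x), γ n * C, fun y hy => ?_, fun c => ?_⟩
      · rw [hd] at hy
        have h1 := EReal.coe_le_coe_iff.1 ((H.gamma0_φ.le_conj _ hy).trans hC.le)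
        rw [neg_apply] at h1
        have h2 : -(γ n • pullGrad ψ L x) y = -(γ n * ((grad ψ (L x)).comp L) y) := rfl
        rw [toReal_scale, neg_apply, smul_apply, smul_eq_mul, pullGrad]
        nlinarith [H.γ_pos n]
      · rw [sub_neg_eq_add, sub_add_cancel]
        exact (H.legendre_fn n).isBounded_sublevel hX
          ((H.legendre_fn n).grad_mem_subdiff (H.mem_intDom_fn n hx)) c
    · obtain ⟨w, C, hw⟩ := hφγ.exists_affine_minorant
      exact ⟨w, C, hw, (hB n).isBounded_sublevel (H.legendre_fn n).gamma0 _⟩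
  obtain ⟨w, C, hw, hb⟩ := hmin
  obtain ⟨z, h1, h2, h3, h4⟩ := (H.legendre_fn n).prox_eq_singleton hX hφγ hp
    (H.mem_intDom_fn n hpU) hw hb
  exact ⟨z, H.intDom_fn n ▸ h1, hd ▸ h2, h3, h4⟩

end Setting

/-- Orbits of the Bregman forward-backward iteration. -/
structure IsOrbit (φ : X → EReal) (ψ : Y → EReal) (L : X →L[ℝ] Y) (f : X → EReal)
    (fn : ℕ → X → EReal) (γ : ℕ → ℝ) (x : ℕ → X) : Prop where
  mem_intDom : ∀ n, x n ∈ intDom f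
  mem_dom : ∀ n, x (n + 1) ∈ dom φ
  inclusion : ∀ n, grad (fn n) (x n) - γ n • pullGrad ψ L (x n) - grad (fn n) (x (n + 1)) ∈
    subdiff (scale (γ n) φ) (x (n + 1))

variable {φ : X → EReal} {ψ : Y → EReal} {L : X →L[ℝ] Y} {f : X → EReal} {β : ℝ}
    {η : ℕ → ℝ} {α : ℝ} {fn : ℕ → X → EReal} {ε : ℝ} {γ : ℕ → ℝ}

theorem Setting.exists_orbit [CompleteSpace X] (H : Setting φ ψ L f β η α fn ε γ)
    (hX : IsReflexive X) (hS : (solutions φ ψ L ∩ intDom f).Nonempty)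
    (hdom : (∀ y ∈ intDom ψ, -((grad ψ y).comp L) ∈ dom (conj φ)) ∨ ∀ n, Cofinite (fn n))
    {x₀ : X} (hx₀ : x₀ ∈ intDom f) :
    ∃ x : ℕ → X, x 0 = x₀ ∧ (∀ n, prox (fn n) (scale (γ n) φ)
      (grad (fn n) (x n) - γ n • pullGrad ψ L (x n)) = {x (n + 1)}) ∧
      IsOrbit φ ψ L f fn γ x := by
  have hstep : ∀ (n : ℕ) (x : intDom f), ∃ z : intDom f, (z : X) ∈ dom φ ∧
      prox (fn n) (scale (γ n) φ) (grad (fn n) (x : X) - γ n • pullGrad ψ L (x : X)) = {(z : X)} ∧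
      grad (fn n) (x : X) - γ n • pullGrad ψ L (x : X) - grad (fn n) (z : X) ∈
        subdiff (scale (γ n) φ) (z : X) := fun n x => by
    obtain ⟨z, h1, h2, h3, h4⟩ := H.exists_step hX hS hdom n x.2
    exact ⟨⟨z, h1⟩, h2, h3, h4⟩
  choose T hT1 hT2 hT3 using hstep
  obtain ⟨s, hs0, hs⟩ : ∃ s : ℕ → intDom f, s 0 = ⟨x₀, hx₀⟩ ∧ ∀ n, s (n + 1) = T n (s n) :=
    ⟨fun n => Nat.rec ⟨x₀, hx₀⟩ T n, rfl, fun _ => rfl⟩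
  refine ⟨fun n => (s n : X), congrArg Subtype.val hs0, fun n => ?_, fun n => (s n).2,
    fun n => ?_, fun n => ?_⟩
  · simp only [hs]; exact hT2 n (s n)
  · simp only [hs]; exact hT1 n (s n)
  · simp only [hs]; exact hT3 n (s n)

/-- The quantity by which the Bregman distance to a solution decreases at step `n`. -/
noncomputable def decrement (φ : X → EReal) (ψ : Y → EReal) (L : X →L[ℝ] Y)
    (fn : ℕ → X → EReal) (ε : ℝ) (γ : ℕ → ℝ) (x : ℕ → X) (p : X) (n : ℕ) : ℝ :=
  γ n * bregmanReal ψ (L p) (L (x n)) + ε * bregmanReal (fn n) (x (n + 1)) (x n) +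
    γ n * (objReal φ ψ L (x (n + 1)) - objReal φ ψ L p)

namespace IsOrbit

variable {x : ℕ → X}

/-- The descent estimate: the three-point identity turns the optimality condition tested at `p` into
a comparison of Bregman distances. Its only positive error, `γₙ D^ψ(Lxₙ₊₁, Lxₙ)`, is paid for by the
fraction `1-ε` of `D^{fₙ}(xₙ₊₁, xₙ)`. -/
theorem bregmanReal_le_sub (hx : IsOrbit φ ψ L f fn γ x) (H : Setting φ ψ L f β η α fn ε γ)
    {p : X} (hp : p ∈ solutions φ ψ L) (n : ℕ) :
    bregmanReal (fn n) p (x (n + 1)) ≤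
      bregmanReal (fn n) p (x n) - decrement φ ψ L fn ε γ x p n := by
  have hγ := H.γ_pos n
  have h1 := bregmanReal_three_point (fn n) p (x n) (x (n + 1))
  have hpφ := (mem_dom_of_mem_solutions H.gamma0_φ H.gamma0_ψ hp).1
  have h2 := (H.gamma0_φ.scale hγ).le_of_mem_subdiff (hx.inclusion n) (y := p)
    (by rwa [dom_scale hγ])
  rw [toReal_scale, toReal_scale] at h2
  set G := grad ψ (L (x n)) with hG
  have hpull : ∀ v, pullGrad ψ L (x n) v = G (L v) := fun v => rfl
  simp only [sub_apply, smul_apply, smul_eq_mul, hpull] at h2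
  rw [sub_apply] at h1
  -- The forward gradient is evaluated at `Lxₙ` but paired with `L(p - xₙ₊₁)`; splitting at `Lxₙ`
  -- produces two Bregman distances of `ψ` with the same base point.
  have h3 : G (L (p - x (n + 1))) =
      (ψ (L p)).toReal - bregmanReal ψ (L p) (L (x n)) - (ψ (L (x (n + 1)))).toReal
        + bregmanReal ψ (L (x (n + 1))) (L (x n)) := by
    simp only [bregmanReal, ← hG, map_sub]
    ring
  rw [h3] at h2
  have h4 := H.bregmanReal_ψ_le (hx.mem_intDom (n + 1)) (hx.mem_intDom n)
  have h5 := H.bregmanReal_f_le n (hx.mem_intDom (n + 1)) (hx.mem_intDom n)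
  have h6 := H.bregmanReal_ψ_nonneg (intDom_subset_dom ψ (H.maps _ (hx.mem_intDom (n + 1))))
    (hx.mem_intDom n)
  -- Otherwise the upper bound on `γₙ` would be negative.
  have h8 : 0 ≤ 1 - ε := by
    by_contra hneg
    push Not at hneg
    have := (H.step n).2
    have : α * β * (1 - ε) < 0 := mul_neg_of_pos_of_neg (mul_pos H.α_pos H.β_pos) hneg
    linarith
  have h7 : γ n * bregmanReal ψ (L (x (n + 1))) (L (x n)) ≤
      (1 - ε) * bregmanReal (fn n) (x (n + 1)) (x n) := by
    calc γ n * bregmanReal ψ (L (x (n + 1))) (L (x n))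
        ≤ α * β * (1 - ε) * bregmanReal ψ (L (x (n + 1))) (L (x n)) :=
          mul_le_mul_of_nonneg_right (H.step n).2 h6
      _ = (1 - ε) * (α * (β * bregmanReal ψ (L (x (n + 1))) (L (x n)))) := by ring
      _ ≤ (1 - ε) * bregmanReal (fn n) (x (n + 1)) (x n) :=
          mul_le_mul_of_nonneg_left
            ((mul_le_mul_of_nonneg_left h4 H.α_pos.le).trans h5) h8
  rw [decrement, objReal, objReal]
  linarith

theorem decrement_terms_nonneg (hx : IsOrbit φ ψ L f fn γ x)
    (H : Setting φ ψ L f β η α fn ε γ)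
    {p : X} (hp : p ∈ solutions φ ψ L) (n : ℕ) :
    0 ≤ γ n * bregmanReal ψ (L p) (L (x n)) ∧
      0 ≤ ε * bregmanReal (fn n) (x (n + 1)) (x n) ∧
      0 ≤ γ n * (objReal φ ψ L (x (n + 1)) - objReal φ ψ L p) := by
  obtain ⟨-, h2⟩ := mem_dom_of_mem_solutions H.gamma0_φ H.gamma0_ψ hp
  refine ⟨mul_nonneg (H.γ_pos n).le (H.bregmanReal_ψ_nonneg h2 (hx.mem_intDom n)),
    mul_nonneg H.ε_pos.le (H.bregmanReal_fn_nonneg n (hx.mem_intDom _) (hx.mem_intDom n)),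
    mul_nonneg (H.γ_pos n).le (sub_nonneg.2 ?_)⟩
  exact objReal_le H.gamma0_φ H.gamma0_ψ hp (hx.mem_dom n)
    (intDom_subset_dom ψ (H.maps _ (hx.mem_intDom (n + 1))))

theorem decrement_nonneg (hx : IsOrbit φ ψ L f fn γ x) (H : Setting φ ψ L f β η α fn ε γ)
    {p : X} (hp : p ∈ solutions φ ψ L) (n : ℕ) : 0 ≤ decrement φ ψ L fn ε γ x p n := by
  obtain ⟨h1, h2, h3⟩ := hx.decrement_terms_nonneg H hp n
  exact add_nonneg (add_nonneg h1 h2) h3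

theorem quasi_fejer (hx : IsOrbit φ ψ L f fn γ x) (H : Setting φ ψ L f β η α fn ε γ)
    {p : X} (hp : p ∈ solutions φ ψ L) (hpU : p ∈ intDom f) (n : ℕ) :
    bregmanReal (fn (n + 1)) p (x (n + 1)) ≤
      (1 + η n) * (bregmanReal (fn n) p (x n) - decrement φ ψ L fn ε γ x p n) :=
  (H.bregmanReal_succ_le n hpU (hx.mem_intDom (n + 1))).trans
    (mul_le_mul_of_nonneg_left (hx.bregmanReal_le_sub H hp n) (by linarith [H.η_nonneg n]))

theorem quasi_antitone (hx : IsOrbit φ ψ L f fn γ x) (H : Setting φ ψ L f β η α fn ε γ)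
    {p : X} (hp : p ∈ solutions φ ψ L) (hpU : p ∈ intDom f) (n : ℕ) :
    bregmanReal (fn (n + 1)) p (x (n + 1)) ≤ (1 + η n) * bregmanReal (fn n) p (x n) :=
  (hx.quasi_fejer H hp hpU n).trans
    (mul_le_mul_of_nonneg_left (by linarith [hx.decrement_nonneg H hp n])
      (by linarith [H.η_nonneg n]))

theorem tendsto_decrement (hx : IsOrbit φ ψ L f fn γ x) (H : Setting φ ψ L f β η α fn ε γ)
    {p : X} (hp : p ∈ solutions φ ψ L) (hpU : p ∈ intDom f) :
    Tendsto (decrement φ ψ L fn ε γ x p) atTop (𝓝 0) :=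
  tendsto_zero_of_quasi_antitone (a := fun n => bregmanReal (fn n) p (x n))
    (fun n => H.bregmanReal_fn_nonneg n hpU (hx.mem_intDom n))
    (hx.decrement_nonneg H hp) H.η_nonneg H.η_summable (hx.quasi_fejer H hp hpU)

theorem exists_tendsto_bregmanReal (hx : IsOrbit φ ψ L f fn γ x)
    (H : Setting φ ψ L f β η α fn ε γ)
    {p : X} (hp : p ∈ solutions φ ψ L) (hpU : p ∈ intDom f) :
    ∃ l, Tendsto (fun n => bregmanReal (fn n) p (x n)) atTop (𝓝 l) :=
  tendsto_of_quasi_antitone (fun n => H.bregmanReal_fn_nonneg n hpU (hx.mem_intDom n))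
    H.η_nonneg H.η_summable (hx.quasi_antitone H hp hpU)

theorem tendsto_mul_bregmanReal_ψ (hx : IsOrbit φ ψ L f fn γ x)
    (H : Setting φ ψ L f β η α fn ε γ)
    {p : X} (hp : p ∈ solutions φ ψ L) (hpU : p ∈ intDom f) :
    Tendsto (fun n => γ n * bregmanReal ψ (L p) (L (x n))) atTop (𝓝 0) := by
  refine squeeze_zero (fun n => (hx.decrement_terms_nonneg H hp n).1) (fun n => ?_)
    (hx.tendsto_decrement H hp hpU)
  obtain ⟨h1, h2, h3⟩ := hx.decrement_terms_nonneg H hp n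
  rw [decrement]; linarith

/-- Since `γₙ ≥ ε`, the objective gap at `xₙ₊₁` is at most `ε⁻¹` times the decrement, which tends to
zero. -/
theorem tendsto_objReal (hx : IsOrbit φ ψ L f fn γ x) (H : Setting φ ψ L f β η α fn ε γ)
    {p : X} (hp : p ∈ solutions φ ψ L) (hpU : p ∈ intDom f) :
    Tendsto (fun n => objReal φ ψ L (x n)) atTop (𝓝 (objReal φ ψ L p)) := by
  rw [← tendsto_add_atTop_iff_nat 1, ← tendsto_sub_nhds_zero_iff]
  have h0 : ∀ n, 0 ≤ objReal φ ψ L (x (n + 1)) - objReal φ ψ L p := fun n =>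
    sub_nonneg.2 (objReal_le H.gamma0_φ H.gamma0_ψ hp (hx.mem_dom n)
      (intDom_subset_dom ψ (H.maps _ (hx.mem_intDom (n + 1)))))
  have hlim := (hx.tendsto_decrement H hp hpU).const_mul ε⁻¹
  rw [mul_zero] at hlim
  refine squeeze_zero h0 (fun n => ?_) hlim
  obtain ⟨h1, h2, h3⟩ := hx.decrement_terms_nonneg H hp n
  rw [le_inv_mul_iff₀ H.ε_pos, decrement]
  have := mul_le_mul_of_nonneg_right (H.step n).1 (h0 n)
  linarith

/-- Bregman distances from a solution are controlled by the earlier ones. -/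
theorem bregmanReal_le_exp_mul (hx : IsOrbit φ ψ L f fn γ x)
    (H : Setting φ ψ L f β η α fn ε γ)
    {p : X} (hp : p ∈ solutions φ ψ L) (hpU : p ∈ intDom f) {k m : ℕ} (hkm : k ≤ m) :
    α * bregmanReal f p (x m) ≤ Real.exp (∑' n, η n) * bregmanReal (fn k) p (x k) :=
  (H.bregmanReal_f_le m hpU (hx.mem_intDom m)).trans
    (le_exp_tsum_mul (a := fun n => bregmanReal (fn n) p (x n))
      (fun n => H.bregmanReal_fn_nonneg n hpU (hx.mem_intDom n)) H.η_nonneg H.η_summable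
      (hx.quasi_antitone H hp hpU) hkm)

theorem exists_bregmanReal_le (hx : IsOrbit φ ψ L f fn γ x)
    (H : Setting φ ψ L f β η α fn ε γ)
    {p : X} (hp : p ∈ solutions φ ψ L) (hpU : p ∈ intDom f) :
    ∃ M, ∀ n, bregmanReal f p (x n) ≤ M :=
  ⟨_, fun n => (le_div_iff₀' H.α_pos).2 (hx.bregmanReal_le_exp_mul H hp hpU (Nat.zero_le n))⟩

end IsOrbit

/-- Left coercivity of the Bregman distance bounds sets on which it is bounded. -/
theorem isBounded_of_bregmanReal_le (hf : Gamma0 f) {p : X}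
    (hp : p ∈ intDom f) (hcoer : Coercive (bregman f p)) (M : ℝ) :
    Bornology.IsBounded {y | y ∈ intDom f ∧ bregmanReal f p y ≤ M} := by
  have h1 : ∀ᶠ y in Bornology.cobounded X, (M : EReal) < bregman f p y :=
    hcoer.eventually_const_lt (EReal.coe_lt_top M)
  rw [← Bornology.isCobounded_compl_iff]
  refine Filter.mem_of_superset (show {y | (M : EReal) < bregman f p y} ∈ _ from h1) ?_
  rintro y hy ⟨hyU, hyM⟩
  have hy' : (M : EReal) < bregman f p y := hy
  rw [hf.bregman_eq (intDom_subset_dom f hp) hyU, EReal.coe_lt_coe_iff] at hy'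
  linarith

theorem IsOrbit.isBounded {x : ℕ → X} (hx : IsOrbit φ ψ L f fn γ x)
    (H : Setting φ ψ L f β η α fn ε γ) {p : X} (hp : p ∈ solutions φ ψ L) (hpU : p ∈ intDom f)
    (hcoer : Coercive (bregman f p)) : Bornology.IsBounded (Set.range x) := by
  obtain ⟨M, hM⟩ := hx.exists_bregmanReal_le H hp hpU
  refine (isBounded_of_bregmanReal_le H.legendre_f.gamma0 hpU hcoer M).subset ?_
  rintro _ ⟨n, rfl⟩
  exact ⟨hx.mem_intDom n, hM n⟩

theorem IsOrbit.weakClusterPts_subset {x : ℕ → X} (hx : IsOrbit φ ψ L f fn γ x)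
    (H : Setting φ ψ L f β η α fn ε γ) {p : X} (hp : p ∈ solutions φ ψ L)
    (hpU : p ∈ intDom f) : weakClusterPts x ⊆ solutions φ ψ L := by
  rintro y ⟨k, hk, hy⟩
  obtain ⟨h1, h2⟩ := mem_dom_of_mem_solutions H.gamma0_φ H.gamma0_ψ hp
  rw [solutions_eq hp]
  refine (gamma0_obj H.gamma0_φ H.gamma0_ψ ⟨p, hp⟩).le_of_weakTendsto hy fun c hc => ?_
  rw [obj_eq H.gamma0_φ H.gamma0_ψ h1 h2, EReal.coe_lt_coe_iff] at hc
  have h3 := (hx.tendsto_objReal H hp hpU).eventually_lt_const hc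
  -- Index `0` is discarded: the starting point need not lie in `dom φ`.
  filter_upwards [hk.tendsto_atTop.eventually h3,
    hk.tendsto_atTop.eventually (eventually_ge_atTop 1)] with n hn hn1
  obtain ⟨m, hm⟩ := Nat.exists_eq_add_of_le' hn1
  rw [obj_eq H.gamma0_φ H.gamma0_ψ (by rw [hm]; exact hx.mem_dom m)
    (intDom_subset_dom ψ (H.maps _ (hx.mem_intDom _))), EReal.coe_le_coe_iff]
  exact hn.le

theorem IsOrbit.weakClusterPts_subset_closure {x : ℕ → X} (hx : IsOrbit φ ψ L f fn γ x)
    (hf : Gamma0 f) : weakClusterPts x ⊆ closure (dom f) := by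
  rintro y ⟨k, hk, hy⟩
  exact mem_of_weakTendsto hf.convex_dom.closure isClosed_closure
    (Eventually.of_forall fun n => subset_closure (intDom_subset_dom f (hx.mem_intDom (k n)))) hy

end Iteration

/-! ### Conjugates, and weak limits in the interior of the domain -/

section Conjugate

variable {E : Type*} [NormedAddCommGroup E] [NormedSpace ℝ E]

theorem Gamma0.conj {f : E → EReal} (hf : Gamma0 f) : Gamma0 (conj f) where
  ne_bot v := by
    obtain ⟨x, hx⟩ := hf.proper
    exact ((EReal.bot_lt_coe _).trans_le (hf.le_conj v hx)).ne'
  lsc := by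
    refine lowerSemicontinuous_iff_isClosed_preimage.2 fun c => ?_
    have : BregmanFB.conj f ⁻¹' Set.Iic c =
        ⋂ x ∈ dom f, {v | ((v x - (f x).toReal : ℝ) : EReal) ≤ c} := by
      ext v
      simp only [Set.mem_preimage, Set.mem_Iic, Set.mem_iInter]
      exact hf.conj_le_iff
    rw [this]
    refine isClosed_biInter fun x _ => isClosed_Iic.preimage
      (f := fun v : StrongDual ℝ E => ((v x - (f x).toReal : ℝ) : EReal)) ?_
    exact continuous_coe_real_ereal.comp (by fun_prop)
  convex u v a b ha hb hab := by
    refine hf.conj_le_iff.2 fun x hx => ?_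
    have h1 : (a • u + b • v) x - (f x).toReal =
        a * (u x - (f x).toReal) + b * (v x - (f x).toReal) := by
      have : (f x).toReal = (a + b) * (f x).toReal := by rw [hab, one_mul]
      rw [add_apply, smul_apply, smul_apply, smul_eq_mul, smul_eq_mul]
      linarith
    rw [h1, EReal.coe_add, EReal.coe_mul, EReal.coe_mul]
    exact add_le_add (mul_le_mul_of_nonneg_left (hf.le_conj u hx) (by exact_mod_cast ha.le))
      (mul_le_mul_of_nonneg_left (hf.le_conj v hx) (by exact_mod_cast hb.le))
  proper := by
    obtain ⟨w, C, hw⟩ := hf.exists_affine_minorant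
    refine ⟨w, mem_dom_of_le_coe (c := C) (hf.conj_le_iff.2 fun x hx => ?_)⟩
    exact EReal.coe_le_coe_iff.2 (by linarith [hw x hx])

/-- Subgradient inversion without the biconjugate theorem. The variational principle centred at `x`
yields `z` with a subgradient `w` of `f - v` satisfying `w (z - x) ≤ -(c * ‖z - x‖)`. The hypothesis
on `f*`, tested at `v + w`, gives `0 ≤ w (z - x)`, so `z = x` and `x` is optimal for `f - v` up to
`c‖· - x‖`. Let `c → 0`. -/
theorem Gamma0.mem_subdiff_of_inclusion_mem (hE : IsReflexive E) {f : E → EReal} (hf : Gamma0 f)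
    {x : E} {v : StrongDual ℝ E}
    (hv : NormedSpace.inclusionInDoubleDual ℝ E x ∈ subdiff (BregmanFB.conj f) v) :
    v ∈ subdiff f x := by
  have hvd := hf.conj.mem_dom_of_mem_subdiff hv
  have hlow : ∀ y ∈ dom f, v y - (f y).toReal ≤ (BregmanFB.conj f v).toReal := fun y hy => by
    have := hf.le_conj v hy
    rwa [← hf.conj.coe_toReal hvd, EReal.coe_le_coe_iff] at this
  have hsmall : ∀ c : ℝ, 0 < c → x ∈ dom f ∧ ∀ y ∈ dom f,
      v (y - x) + (f x).toReal ≤ (f y).toReal + c * ‖y - x‖ := by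
    intro c hc
    obtain ⟨z, hz, w, hw, hwc, hwz, -⟩ := (hf.sub_dual v).exists_small_subgradient hE
      (m := -(BregmanFB.conj f v).toReal) (fun y hy => by
        rw [dom_sub_dual] at hy
        rw [hf.toReal_sub_dual v hy]
        linarith [hlow y hy]) x hc
    rw [dom_sub_dual] at hz
    have hwv := hf.add_mem_subdiff hw
    have h1 := hv (w + v)
    rw [hf.conj_eq hwv, ← hf.conj.coe_toReal hvd, ← EReal.coe_add, EReal.coe_le_coe_iff,
      NormedSpace.dual_def, add_sub_cancel_right, add_apply] at h1
    have h2 := hlow z hz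
    have h3 : 0 ≤ w (z - x) := by rw [map_sub]; linarith
    have h4 : ‖z - x‖ ≤ 0 := by
      by_contra hpos
      push Not at hpos
      nlinarith
    obtain rfl : z = x := sub_eq_zero.1 (norm_le_zero_iff.1 h4)
    refine ⟨hz, fun y hy => ?_⟩
    have h5 := hf.le_of_mem_subdiff hwv hy
    rw [add_apply] at h5
    have h6 : -(c * ‖y - z‖) ≤ w (y - z) := by
      have := (abs_le.1 (w.le_opNorm (y - z))).1
      have := mul_le_mul_of_nonneg_right hwc (norm_nonneg (y - z))
      linarith
    linarith
  have hxd := (hsmall 1 one_pos).1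
  refine (hf.mem_subdiff_iff hxd).2 fun y hy => le_of_forall_pos_le_add fun e he => ?_
  have h1 := (hsmall (e / (‖y - x‖ + 1)) (by positivity)).2 y hy
  have h2 : e / (‖y - x‖ + 1) * ‖y - x‖ ≤ e := by
    rw [div_mul_eq_mul_div, div_le_iff₀ (by positivity)]
    nlinarith [norm_nonneg (y - x)]
  linarith

/-- A lower bound by an affine function along one segment extends to a global subgradient, by the
sandwich of `f` with that function restricted to the segment. It stands in for the max formula for
directional derivatives; `d = 0` gives mere existence. -/
theorem Gamma0.exists_subgradient_of_segment [CompleteSpace E] {f : E → EReal} (hf : Gamma0 f)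
    {v d : E} (hv : v ∈ intDom f) (l : StrongDual ℝ E)
    (hl : ∀ t : ℝ, 0 ≤ t → t ≤ 1 → v + t • d ∈ dom f →
      (f v).toReal + t * l d ≤ (f (v + t • d)).toReal) :
    ∃ u ∈ subdiff f v, l d ≤ u d := by
  have hvd := intDom_subset_dom f hv
  obtain ⟨K, r, hr, hK⟩ := hf.exists_bound hv
  set C := segment ℝ v (v + d) with hC
  have hvC : v ∈ C := left_mem_segment ℝ _ _
  have hdC : v + d ∈ C := right_mem_segment ℝ _ _
  have hCeq : ∀ x ∈ C, ∃ t : ℝ, 0 ≤ t ∧ t ≤ 1 ∧ x = v + t • d := fun x hx => by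
    rw [hC, segment_eq_image'] at hx
    obtain ⟨t, ht, rfl⟩ := hx
    exact ⟨t, ht.1, ht.2, by simp⟩
  have hClosed : IsClosed C := by
    have hcont : Continuous fun t : ℝ => v + t • (v + d - v) := by fun_prop
    rw [hC, segment_eq_image']
    exact (isCompact_Icc.image hcont).isClosed
  set r' : E → ℝ := fun x => -((f v).toReal + l (x - v)) with hr'
  have hreal : Gamma0 (fun x => (r' x : EReal)) := by
    refine Gamma0.of_real ⟨convex_univ, fun x _ y _ a b _ _ hab => ?_⟩ (by fun_prop)
    simp only [hr', smul_eq_mul, map_sub, map_add, map_smul]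
    have h1 : (f v).toReal = (a + b) * (f v).toReal := by rw [hab, one_mul]
    have h2 : l v = (a + b) * l v := by rw [hab, one_mul]
    linarith
  have hne : (dom (indicatorFn C) ∩ dom fun x => (r' x : EReal)).Nonempty :=
    ⟨v, by rwa [dom_indicatorFn], EReal.coe_lt_top _⟩
  have hG := (gamma0_indicatorFn (convex_segment v (v + d)) hClosed ⟨v, hvC⟩).add hreal hne
  have hdG : dom (fun x => indicatorFn C x + (r' x : EReal)) = C := by
    rw [dom_add (gamma0_indicatorFn (convex_segment v (v + d)) hClosed ⟨v, hvC⟩).ne_bot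
      hreal.ne_bot, dom_indicatorFn]
    exact Set.inter_eq_left.2 fun x _ => EReal.coe_lt_top _
  have hvG : ∀ x ∈ C, (indicatorFn C x + (r' x : EReal)).toReal = r' x := fun x hx => by
    rw [indicatorFn_of_mem hx, zero_add, EReal.toReal_coe]
  obtain ⟨u, c, hu1, hu2⟩ := exists_affine_between hf hG (p := v) hr hK
    (by rwa [hdG]) (fun x hx => by
      rw [hdG] at hx
      rw [hvG x hx.2]
      obtain ⟨t, ht0, ht1, rfl⟩ := hCeq x hx.2
      have := hl t ht0 ht1 hx.1
      simp only [hr', add_sub_cancel_left, map_smul, smul_eq_mul]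
      linarith)
  rw [hdG] at hu2
  have h1 := hu1 v hvd
  have h2 := hu2 v hvC
  have h3 := hu2 (v + d) hdC
  rw [hvG v hvC] at h2
  rw [hvG _ hdC] at h3
  simp only [hr', sub_self, map_zero, add_sub_cancel_left, map_add] at h2 h3
  refine ⟨u, (hf.mem_subdiff_iff hvd).2 fun y hy => ?_, by linarith⟩
  rw [map_sub]; linarith [hu1 y hy]

/-- A unique subgradient at an interior point of the domain is the Gâteaux gradient. -/
theorem Gamma0.hasGateauxGrad_of_unique [CompleteSpace E] {f : E → EReal} (hf : Gamma0 f)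
    {v : E} (hv : v ∈ intDom f) {u : StrongDual ℝ E} (hu : u ∈ subdiff f v)
    (huniq : ∀ u' ∈ subdiff f v, u' = u) : HasGateauxGrad f u v := by
  have hvd := intDom_subset_dom f hv
  have hupper : ∀ d : E, ∀ e : ℝ, 0 < e → ∃ t₀ : ℝ, 0 < t₀ ∧ ∀ t : ℝ, 0 ≤ t → t ≤ t₀ →
      v + t • d ∈ dom f ∧ (f (v + t • d)).toReal ≤ (f v).toReal + t * (u d + e) := by
    intro d e he
    have hex : ∃ t₀ : ℝ, 0 < t₀ ∧ v + t₀ • d ∈ dom f ∧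
        (f (v + t₀ • d)).toReal ≤ (f v).toReal + t₀ * (u d + e) := by
      rcases eq_or_ne d 0 with rfl | hd
      · exact ⟨1, one_pos, by simpa using hvd, by simpa using he.le⟩
      by_contra hcon
      push Not at hcon
      -- If no point of the ray lay below slope `u d + e`, the functional `(u d + e) • κ` would
      -- yield a subgradient with value at least `u d + e` at `d`, contradicting uniqueness. One
      -- good `t₀` suffices, since convexity handles smaller `t`.
      obtain ⟨κ, hκ⟩ := SeparatingDual.exists_eq_one (R := ℝ) hd
      obtain ⟨u', hu', hle⟩ := hf.exists_subgradient_of_segment hv ((u d + e) • κ) (d := d)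
        fun t ht0 _ htd => by
          rw [smul_apply, hκ, smul_eq_mul, mul_one]
          rcases ht0.eq_or_lt with rfl | ht
          · simp
          · exact (hcon t ht htd).le
      rw [smul_apply, hκ, smul_eq_mul, mul_one, huniq u' hu'] at hle
      linarith
    obtain ⟨t₀, ht₀, hd₀, hle⟩ := hex
    refine ⟨t₀, ht₀, fun t ht0 ht1 => ?_⟩
    have ha : 0 ≤ t / t₀ := by positivity
    have hb : 0 ≤ 1 - t / t₀ := by
      have := (div_le_one ht₀).2 ht1
      linarith
    have heq : v + t • d = (1 - t / t₀) • v + (t / t₀) • (v + t₀ • d) := by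
      rw [smul_add, smul_smul, div_mul_cancel₀ _ ht₀.ne']
      module
    have hcombo := hf.le_combo (hf.coe_toReal hvd).ge (hf.coe_toReal hd₀).ge hb ha (by ring)
    rw [← heq] at hcombo
    refine ⟨mem_dom_of_le_coe hcombo, (hf.toReal_le hcombo).trans ?_⟩
    have h1 := mul_le_mul_of_nonneg_left hle ha
    have h2 : t / t₀ * ((f v).toReal + t₀ * (u d + e)) =
        t / t₀ * (f v).toReal + t * (u d + e) := by field_simp
    linarith
  intro d
  rw [HasLineDerivAt, hasDerivAt_iff_isLittleO_nhds_zero, Asymptotics.isLittleO_iff]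
  intro e he
  obtain ⟨t₁, ht₁, h1⟩ := hupper d e he
  obtain ⟨t₂, ht₂, h2⟩ := hupper (-d) e he
  filter_upwards [Ioo_mem_nhds (neg_lt_zero.2 ht₂) ht₁] with t ht
  have hlow : v + t • d ∈ dom f → (f v).toReal + t * u d ≤ (f (v + t • d)).toReal := fun hmem => by
    have := hf.le_of_mem_subdiff hu hmem
    rw [add_sub_cancel_left, map_smul, smul_eq_mul] at this
    linarith
  simp only [zero_add, zero_smul, add_zero, smul_eq_mul, Real.norm_eq_abs]
  rcases le_total 0 t with h0 | h0
  · obtain ⟨hmem, hle⟩ := h1 t h0 ht.2.le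
    have := hlow hmem
    rw [abs_of_nonneg h0, abs_le]
    have := mul_nonneg he.le h0
    constructor <;> linarith
  · obtain ⟨hmem, hle⟩ := h2 (-t) (by linarith) (by linarith [ht.1])
    rw [neg_smul_neg] at hmem hle
    rw [map_neg] at hle
    have := hlow hmem
    rw [abs_of_nonpos h0, abs_le]
    have := mul_nonneg he.le (neg_nonneg.2 h0)
    constructor <;> linarith

theorem IsLegendre.eq_of_common_subgradient {f : E → EReal} (hf : IsLegendre f) {x y : E}
    {v : StrongDual ℝ E} (hx : v ∈ subdiff f x) (hy : v ∈ subdiff f y) : x = y := by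
  by_contra hne
  have hf0 := hf.gamma0
  have hxd := hf0.mem_dom_of_mem_subdiff hx
  have hyd := hf0.mem_dom_of_mem_subdiff hy
  have h1 := hf.strict x (hf.domSubdiff_subset hx) y (hf.domSubdiff_subset hy) hne (1 / 2) (1 / 2)
    (by norm_num) (by norm_num) (by norm_num)
  set z := (1 / 2 : ℝ) • x + (1 / 2 : ℝ) • y with hz
  have hzd : z ∈ dom f := hf0.convex_dom hxd hyd (by norm_num) (by norm_num) (by norm_num)
  rw [← hf0.coe_toReal hzd, ← hf0.coe_toReal hxd, ← hf0.coe_toReal hyd, ← EReal.coe_mul,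
    ← EReal.coe_mul, ← EReal.coe_add, EReal.coe_lt_coe_iff] at h1
  have h2 := hf0.le_of_mem_subdiff hx hzd
  have h3 := hf0.le_of_mem_subdiff hy hzd
  have h4 : v z = 1 / 2 * v x + 1 / 2 * v y := by
    rw [hz, map_add, map_smul, map_smul]; rfl
  rw [map_sub] at h2 h3
  linarith

/-- Strict convexity of `f` means that a functional is a subgradient at one point at most. By
inversion `∂f*` is then single-valued, so on the open set `dom f*` its element is the Gâteaux
gradient. -/
theorem IsLegendre.grad_conj (hE : IsReflexive E) {f : E → EReal} (hf : IsLegendre f)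
    (hopen : IsOpen (dom (conj f))) {v : StrongDual ℝ E} (hv : v ∈ dom (conj f)) :
    ∃ y, v ∈ subdiff f y ∧ grad (conj f) v = NormedSpace.inclusionInDoubleDual ℝ E y := by
  have hvi : v ∈ intDom (conj f) := by rwa [intDom, hopen.interior_eq]
  obtain ⟨ζ, hζ, -⟩ := hf.gamma0.conj.exists_subgradient_of_segment hvi 0 (d := 0)
    fun t _ _ _ => by simp
  obtain ⟨y, rfl⟩ := hE ζ
  have hy := hf.gamma0.mem_subdiff_of_inclusion_mem hE hζ
  refine ⟨y, hy, (hf.gamma0.conj.hasGateauxGrad_of_unique hvi hζ fun ζ' hζ' => ?_).grad_eq⟩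
  obtain ⟨y', rfl⟩ := hE ζ'
  rw [hf.eq_of_common_subgradient (hf.gamma0.mem_subdiff_of_inclusion_mem hE hζ') hy]

/-- The bounded distances `D^f(p, xₙ)` bound the gradients `∇f(xₙ)`. A weak limit `v` of these lies
in `dom f*`, and `xₙ = ∇f*(∇f(xₙ))` tends weakly along a subsequence to `∇f*(v)`, a point of `dom ∂f
⊆ int dom f`. -/
theorem IsLegendre.mem_intDom_of_weakTendsto [CompleteSpace E] (hE : IsReflexive E)
    {f : E → EReal} (hf : IsLegendre f) (hopen : IsOpen (dom (conj f)))
    (hcont : WeakSeqContinuousOn (grad (conj f)) (dom (conj f))) {p : E} (hp : p ∈ intDom f)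
    {M : ℝ} {x : ℕ → E} {y : E} (hx : ∀ n, x n ∈ intDom f) (hM : ∀ n, bregmanReal f p (x n) ≤ M)
    (hy : WeakTendsto x y) : y ∈ intDom f := by
  have hf0 := hf.gamma0
  obtain ⟨K, r, hr, hK⟩ := hf0.exists_bound hp
  have hbound : ∀ n d, ‖d‖ < r → grad f (x n) d ≤ K - (f p).toReal + M := fun n d hd => by
    have h1 := hf0.le_of_mem_subdiff (hf.grad_mem_subdiff (hx n))
      (mem_dom_of_le_coe (hK d hd))
    have h2 := hf0.toReal_le (hK d hd)
    have h3 := hM n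
    rw [bregmanReal] at h3
    rw [show p + d - x n = (p - x n) + d by abel, map_add] at h1
    linarith
  have hA0 : 0 ≤ K - (f p).toReal + M := by
    simpa using hbound 0 0 (by simpa using hr)
  have hnorm : ∀ n, ‖grad f (x n)‖ ≤ (K - (f p).toReal + M) / (r / 2) := fun n => by
    have hunit : ∀ z : E, ‖z‖ = 1 → grad f (x n) z ≤ (K - (f p).toReal + M) / (r / 2) :=
      fun z hz => by
        have := hbound n ((r / 2) • z) (by
          rw [norm_smul, hz, mul_one, Real.norm_of_nonneg (by positivity)]; linarith)
        rw [map_smul, smul_eq_mul] at this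
        rw [le_div_iff₀ (by positivity)]; linarith
    refine ContinuousLinearMap.opNorm_le_of_unit_norm (by positivity) fun z hz => ?_
    refine abs_le.2 ⟨?_, hunit z hz⟩
    have := hunit (-z) (by rwa [norm_neg])
    rw [map_neg] at this
    linarith
  obtain ⟨v, k, hk, hv⟩ := hE.dual.exists_weakTendsto_subseq hnorm
  have hconj : ∀ n, conj f (grad f (x n)) =
      ((grad f (x n) (x n) - (f (x n)).toReal : ℝ) : EReal) := fun n =>
    hf0.conj_eq (hf.grad_mem_subdiff (hx n))
  have heval : ∀ z : E, Tendsto (fun n => grad f (x (k n)) z) atTop (𝓝 (v z)) := fun z =>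
    hv (NormedSpace.inclusionInDoubleDual ℝ E z)
  -- `f*(∇f(xₙ)) = D^f(p, xₙ) - f(p) + ∇f(xₙ)(p)`, which stays bounded in the limit.
  have hvdom : v ∈ dom (conj f) := by
    refine mem_dom_of_le_coe (c := M - (f p).toReal + v p)
      (hf0.conj_le_iff.2 fun z hz => EReal.coe_le_coe_iff.2 ?_)
    refine le_of_tendsto_of_tendsto' ((heval z).sub_const _) ((heval p).const_add _) fun n => ?_
    have h1 := hf0.le_of_mem_subdiff (hf.grad_mem_subdiff (hx (k n))) hz
    have h3 := hM (k n)
    rw [bregmanReal] at h3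
    rw [map_sub] at h1 h3
    linarith
  have hlim := hcont (fun n => grad f (x (k n))) v
    (fun n => by
      change conj f _ < ⊤
      rw [hconj]; exact EReal.coe_lt_top _) hvdom hv
  obtain ⟨y', hy', hgrad⟩ := hf.grad_conj hE hopen hvdom
  have hgradn : ∀ n, grad (conj f) (grad f (x n)) = NormedSpace.inclusionInDoubleDual ℝ E (x n) :=
    fun n => by
      obtain ⟨z, hz, hz'⟩ := hf.grad_conj hE hopen (v := grad f (x n)) (by
        change conj f _ < ⊤
        rw [hconj]; exact EReal.coe_lt_top _)
      rw [hz', hf.eq_of_common_subgradient hz (hf.grad_mem_subdiff (hx n))]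
  have hweak : WeakTendsto (fun n => x (k n)) y' := fun u => by
    have := hlim (NormedSpace.inclusionInDoubleDual ℝ (StrongDual ℝ E) u)
    simpa only [hgradn, hgrad, NormedSpace.dual_def] using this
  rw [(hy.comp hk).unique hweak]
  exact hf.domSubdiff_subset hy'

end Conjugate

/-! ### Uniform convexity at a point -/

section UniformConvexity

variable {E : Type*} [NormedAddCommGroup E] [NormedSpace ℝ E]

/-- Only the midpoint `a = 1/2` is used; the factor `4` is `1 / (a * (1 - a))`. An infinite modulus
is impossible because the right-hand side of the definition is finite on `dom h`. -/
theorem UniformlyConvexAt.exists_modulus {h : E → EReal} (hh : Gamma0 h) {z : E}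
    (hu : UniformlyConvexAt h z) : ∃ m : ℝ≥0 → ℝ≥0∞, Monotone m ∧ (∀ t, 0 < t → 0 < m t) ∧
      ∀ y ∈ dom h, m ‖z - y‖₊ ≤ ENNReal.ofReal (4 * ((1 / 2) * (h z).toReal +
        (1 / 2) * (h y).toReal - (h ((1 / 2 : ℝ) • z + (1 / 2 : ℝ) • y)).toReal)) := by
  obtain ⟨hz, m, hm, hm0, hconv⟩ := hu
  refine ⟨m, hm, fun t ht => pos_iff_ne_zero.2 fun h0 => ht.ne' ((hm0 t).1 h0), fun y hy => ?_⟩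
  have h1 := hconv y hy (1 / 2) (by norm_num) (by norm_num)
  have hhalf : (1 - 1 / 2 : ℝ) = 1 / 2 := by norm_num
  rw [hhalf] at h1
  have hmid : (1 / 2 : ℝ) • z + (1 / 2 : ℝ) • y ∈ dom h :=
    hh.convex_dom hz hy (by norm_num) (by norm_num) (by norm_num)
  rw [← hh.coe_toReal hmid, ← hh.coe_toReal hz, ← hh.coe_toReal hy] at h1
  generalize m ‖z - y‖₊ = w at h1 ⊢
  induction w using ENNReal.recTopCoe with
  | top =>
    rw [EReal.coe_ennreal_top, EReal.coe_mul_top_of_pos (by norm_num), EReal.coe_add_top,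
      top_le_iff, ← EReal.coe_mul, ← EReal.coe_mul, ← EReal.coe_add] at h1
    exact absurd h1 (EReal.coe_ne_top _)
  | coe r =>
    have h2 : (((r : ℝ≥0∞)) : EReal) = ((r : ℝ) : EReal) := rfl
    rw [h2, ← EReal.coe_mul, ← EReal.coe_add, ← EReal.coe_mul, ← EReal.coe_mul, ← EReal.coe_add,
      EReal.coe_le_coe_iff] at h1
    rw [← ENNReal.ofReal_coe_nnreal]
    refine ENNReal.ofReal_le_ofReal ?_
    linarith

theorem tendsto_of_tendsto_modulus {m : ℝ≥0 → ℝ≥0∞} (hm : Monotone m)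
    (hm0 : ∀ t, 0 < t → 0 < m t) {z : E} {x : ℕ → E} {r : ℕ → ℝ} (hr : Tendsto r atTop (𝓝 0))
    (h : ∀ᶠ n in atTop, m ‖z - x n‖₊ ≤ ENNReal.ofReal (r n)) : Tendsto x atTop (𝓝 z) := by
  rw [Metric.tendsto_nhds]
  intro e he
  lift e to ℝ≥0 using he.le
  have h1 : Tendsto (fun n => ENNReal.ofReal (r n)) atTop (𝓝 0) := by
    simpa using ENNReal.tendsto_ofReal hr
  filter_upwards [h, h1.eventually_lt_const (hm0 e (by exact_mod_cast he))] with n hn hn2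
  have h2 : ‖z - x n‖₊ < e := by
    by_contra hge
    exact absurd (hm (not_lt.1 hge)) (not_le.2 (hn.trans_lt hn2))
  rw [dist_comm, dist_eq_norm]
  exact_mod_cast h2

end UniformConvexity

/-! ### Bregman projections -/

section Projection

variable {E : Type*} [NormedAddCommGroup E] [NormedSpace ℝ E]

/-- The Bregman projection onto a closed convex set. -/
theorem IsLegendre.exists_projection [CompleteSpace E] (hE : IsReflexive E) {f : E → EReal}
    (hf : IsLegendre f) {C : Set E} (hC : Convex ℝ C) (hcl : IsClosed C) {p : E} (hp : p ∈ C)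
    (hpf : p ∈ intDom f) {x : E} (hx : x ∈ intDom f) :
    ∃ s ∈ C, s ∈ intDom f ∧ ∀ z ∈ C, bregmanReal f z s + bregmanReal f s x ≤ bregmanReal f z x := by
  have hι := gamma0_indicatorFn hC hcl ⟨p, hp⟩
  have hd := dom_indicatorFn C
  have h0 : ∀ y ∈ C, (indicatorFn C y).toReal = 0 := fun y hy => by
    rw [indicatorFn_of_mem hy, EReal.toReal_zero]
  -- The projection is the proximity operator of the indicator of `C` at `∇f(x)`. Its optimality
  -- condition and the three-point identity give the Pythagorean inequality.
  obtain ⟨s, hs1, hs2, -, hs3⟩ := hf.prox_eq_singleton hE hι (p := p) (by rwa [hd]) hpf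
    (u := grad f x) (w := 0) (C := 0) (fun y hy => by
      rw [hd] at hy
      simp [h0 y hy]) (fun c => by
      rw [sub_zero]
      exact hf.isBounded_sublevel hE (hf.grad_mem_subdiff hx) c)
  rw [hd] at hs2
  refine ⟨s, hs2, hs1, fun z hz => ?_⟩
  have h1 := hι.le_of_mem_subdiff hs3 (y := z) (by rwa [hd])
  rw [h0 z hz, h0 s hs2] at h1
  have h2 := bregmanReal_three_point f z x s
  linarith

theorem le_bregmanDist {f : E → EReal} (hf : Gamma0 f) {C : Set E} {y : E} (hy : y ∈ intDom f)
    {c : ℝ} (h : ∀ z ∈ C, z ∈ dom f → c ≤ bregmanReal f z y) : (c : EReal) ≤ bregmanDist f C y := by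
  refine le_iInf₂ fun z hz => ?_
  by_cases hzf : z ∈ dom f
  · rw [hf.bregman_eq hzf hy]
    exact EReal.coe_le_coe_iff.2 (h z hz hzf)
  · have h1 : f z = ⊤ := not_lt_top_iff.1 hzf
    rw [bregman, if_pos hy, h1, ← hf.coe_toReal (intDom_subset_dom f hy), EReal.top_sub_coe,
      EReal.top_sub_coe]
    exact le_top

end Projection

/-! ### Weak and strong convergence of the orbit -/

section Convergence

variable {X Y : Type*} [NormedAddCommGroup X] [NormedSpace ℝ X]
  [NormedAddCommGroup Y] [NormedSpace ℝ Y]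
  {φ : X → EReal} {ψ : Y → EReal} {L : X →L[ℝ] Y} {f : X → EReal} {β : ℝ}
    {η : ℕ → ℝ} {α : ℝ} {fn : ℕ → X → EReal} {ε : ℝ} {γ : ℕ → ℝ} {x : ℕ → X}

/-- The step-size condition says exactly that `αβ - γₙ`, which is nonnegative, grows by at most the
factor `1+ηₙ`. -/
theorem Setting.exists_tendsto_step (H : Setting φ ψ L f β η α fn ε γ)
    (hγη : ∀ n, (1 + η n) * γ n - γ (n + 1) ≤ α * β * η n) : ∃ l, Tendsto γ atTop (𝓝 l) := by
  have hαβ := mul_pos H.α_pos H.β_pos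
  obtain ⟨l, hl⟩ := tendsto_of_quasi_antitone (a := fun n => α * β - γ n) (fun n => by
    have := (H.step n).2
    have := mul_nonneg hαβ.le H.ε_pos.le
    linarith) H.η_nonneg H.η_summable (fun n => by linarith [hγη n])
  exact ⟨α * β - l, by simpa using hl.const_sub (α * β)⟩

/-- Along the orbit, the pairing with differences of interior solutions converges. -/
theorem IsOrbit.exists_tendsto_pairing (hx : IsOrbit φ ψ L f fn γ x)
    (H : Setting φ ψ L f β η α fn ε γ)
    (hγη : ∀ n, (1 + η n) * γ n - γ (n + 1) ≤ α * β * η n) {z y₁ y₂ : X} (hz : z ∈ intDom f)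
    (h₁ : y₁ ∈ solutions φ ψ L) (h₁' : y₁ ∈ intDom f)
    (h₂ : y₂ ∈ solutions φ ψ L) (h₂' : y₂ ∈ intDom f) :
    ∃ l : ℝ, Tendsto
      (fun n => (grad (fn n) (x n) - grad (fn n) z - γ n • pullGrad ψ L (x n)) (y₁ - y₂))
      atTop (𝓝 l) := by
  obtain ⟨lγ, hlγ⟩ := H.exists_tendsto_step hγη
  have hconv : ∀ y ∈ intDom f, ∃ l, Tendsto (fun n => bregmanReal (fn n) y z) atTop (𝓝 l) :=
    fun y hy => tendsto_of_quasi_antitone (fun n => H.bregmanReal_fn_nonneg n hy hz)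
      H.η_nonneg H.η_summable fun n => H.bregmanReal_succ_le n hy hz
  obtain ⟨a₁, ha₁⟩ := hconv y₁ h₁'
  obtain ⟨a₂, ha₂⟩ := hconv y₂ h₂'
  obtain ⟨b₁, hb₁⟩ := hx.exists_tendsto_bregmanReal H h₁ h₁'
  obtain ⟨b₂, hb₂⟩ := hx.exists_tendsto_bregmanReal H h₂ h₂'
  have hc₁ := hx.tendsto_mul_bregmanReal_ψ H h₁ h₁'
  have hc₂ := hx.tendsto_mul_bregmanReal_ψ H h₂ h₂'
  -- The pairing equals `[Dₙ(y₁,z) - Dₙ(y₂,z)] - [Dₙ(y₁,xₙ) - Dₙ(y₂,xₙ)]`, plus `γₙ` times the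
  -- difference of the `D^ψ(Lyᵢ, Lxₙ)`, minus `γₙ(ψ(Ly₁) - ψ(Ly₂))`, where `Dₙ = D^{fₙ}`. Each piece
  -- converges.
  have hall := ((((ha₁.sub ha₂).sub (hb₁.sub hb₂)).add (hc₁.sub hc₂)).sub
    (hlγ.mul_const ((ψ (L y₁)).toReal - (ψ (L y₂)).toReal)))
  refine ⟨_, hall.congr fun n => ?_⟩
  simp only [bregmanReal, sub_apply, smul_apply, smul_eq_mul, pullGrad,
    ContinuousLinearMap.comp_apply, map_sub]
  ring

theorem objReal_eq (hφ : Gamma0 φ) (hψ : Gamma0 ψ) {p q : X} (hp : p ∈ solutions φ ψ L)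
    (hq : q ∈ solutions φ ψ L) : objReal φ ψ L p = objReal φ ψ L q := by
  obtain ⟨hp1, hp2⟩ := mem_dom_of_mem_solutions hφ hψ hp
  obtain ⟨hq1, hq2⟩ := mem_dom_of_mem_solutions hφ hψ hq
  exact le_antisymm (objReal_le hφ hψ hp hq1 hq2) (objReal_le hφ hψ hq hp1 hp2)

/-- Midpoint comparison of the objective with its minimal value. -/
theorem objReal_mid (hφ : Gamma0 φ) (hψ : Gamma0 ψ) {q y : X} (hq : q ∈ solutions φ ψ L)
    (hy : y ∈ dom φ) (hy' : L y ∈ dom ψ) :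
    (1 / 2 * (φ q).toReal + 1 / 2 * (φ y).toReal
        - (φ ((1 / 2 : ℝ) • q + (1 / 2 : ℝ) • y)).toReal) +
      (1 / 2 * (ψ (L q)).toReal + 1 / 2 * (ψ (L y)).toReal
        - (ψ ((1 / 2 : ℝ) • L q + (1 / 2 : ℝ) • L y)).toReal) ≤
      1 / 2 * (objReal φ ψ L y - objReal φ ψ L q) ∧
    0 ≤ 1 / 2 * (φ q).toReal + 1 / 2 * (φ y).toReal
        - (φ ((1 / 2 : ℝ) • q + (1 / 2 : ℝ) • y)).toReal ∧
    0 ≤ 1 / 2 * (ψ (L q)).toReal + 1 / 2 * (ψ (L y)).toReal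
        - (ψ ((1 / 2 : ℝ) • L q + (1 / 2 : ℝ) • L y)).toReal := by
  obtain ⟨hq1, hq2⟩ := mem_dom_of_mem_solutions hφ hψ hq
  have hL : L ((1 / 2 : ℝ) • q + (1 / 2 : ℝ) • y) = (1 / 2 : ℝ) • L q + (1 / 2 : ℝ) • L y := by
    rw [map_add, map_smul, map_smul]
  have h1 := objReal_le hφ hψ hq (x := (1 / 2 : ℝ) • q + (1 / 2 : ℝ) • y)
    (hφ.convex_dom hq1 hy (by norm_num) (by norm_num) (by norm_num))
    (by rw [hL]; exact hψ.convex_dom hq2 hy' (by norm_num) (by norm_num) (by norm_num))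
  have h2 := hφ.toReal_combo_le hq1 hy (a := 1 / 2) (b := 1 / 2) (by norm_num) (by norm_num)
    (by norm_num)
  have h3 := hψ.toReal_combo_le hq2 hy' (a := 1 / 2) (b := 1 / 2) (by norm_num) (by norm_num)
    (by norm_num)
  simp only [objReal, hL] at h1 ⊢
  refine ⟨?_, ?_, ?_⟩ <;> linarith

theorem IsOrbit.tendsto_two_mul_gap (hx : IsOrbit φ ψ L f fn γ x)
    (H : Setting φ ψ L f β η α fn ε γ) {p q : X} (hp : p ∈ solutions φ ψ L)
    (hpU : p ∈ intDom f) (hq : q ∈ solutions φ ψ L) :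
    Tendsto (fun n => 2 * (objReal φ ψ L (x n) - objReal φ ψ L q)) atTop (𝓝 0) := by
  have hlim := ((hx.tendsto_objReal H hp hpU).sub_const (objReal φ ψ L q)).const_mul 2
  rwa [objReal_eq H.gamma0_φ H.gamma0_ψ hp hq, sub_self, mul_zero] at hlim

theorem IsOrbit.eventually_mem (hx : IsOrbit φ ψ L f fn γ x)
    (H : Setting φ ψ L f β η α fn ε γ) : ∀ᶠ n in atTop, x n ∈ dom φ ∧ L (x n) ∈ dom ψ := by
  filter_upwards [eventually_ge_atTop 1] with n hn
  obtain ⟨m, rfl⟩ := Nat.exists_eq_add_of_le' hn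
  exact ⟨hx.mem_dom m, intDom_subset_dom ψ (H.maps _ (hx.mem_intDom _))⟩

theorem IsOrbit.tendsto_of_uniformlyConvexAt_left (hx : IsOrbit φ ψ L f fn γ x)
    (H : Setting φ ψ L f β η α fn ε γ) {p q : X} (hp : p ∈ solutions φ ψ L)
    (hpU : p ∈ intDom f) (hq : q ∈ solutions φ ψ L) (hu : UniformlyConvexAt φ q) :
    Tendsto x atTop (𝓝 q) := by
  obtain ⟨m, hm, hm0, hbound⟩ := hu.exists_modulus H.gamma0_φ
  refine tendsto_of_tendsto_modulus hm hm0 (hx.tendsto_two_mul_gap H hp hpU hq) ?_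
  filter_upwards [hx.eventually_mem H] with n hn
  obtain ⟨h1, -, h2⟩ := objReal_mid H.gamma0_φ H.gamma0_ψ hq hn.1 hn.2
  exact (hbound _ hn.1).trans (ENNReal.ofReal_le_ofReal (by linarith))

theorem IsOrbit.tendsto_of_uniformlyConvexAt_right (hx : IsOrbit φ ψ L f fn γ x)
    (H : Setting φ ψ L f β η α fn ε γ) {p q : X} (hp : p ∈ solutions φ ψ L)
    (hpU : p ∈ intDom f) (hq : q ∈ solutions φ ψ L) (hu : UniformlyConvexAt ψ (L q))
    {κ : ℝ} (hκ : 0 < κ) (hL : ∀ v : X, κ * ‖v‖ ≤ ‖L v‖) : Tendsto x atTop (𝓝 q) := by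
  obtain ⟨m, hm, hm0, hbound⟩ := hu.exists_modulus H.gamma0_ψ
  have hlim : Tendsto (fun n => L (x n)) atTop (𝓝 (L q)) := by
    refine tendsto_of_tendsto_modulus hm hm0 (hx.tendsto_two_mul_gap H hp hpU hq) ?_
    filter_upwards [hx.eventually_mem H] with n hn
    obtain ⟨h1, h2, -⟩ := objReal_mid H.gamma0_φ H.gamma0_ψ hq hn.1 hn.2
    exact (hbound _ hn.2).trans (ENNReal.ofReal_le_ofReal (by linarith))
  rw [tendsto_iff_norm_sub_tendsto_zero] at hlim ⊢
  have hlim' := hlim.const_mul κ⁻¹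
  rw [mul_zero] at hlim'
  refine squeeze_zero (fun _ => norm_nonneg _) (fun n => ?_) hlim'
  rw [le_inv_mul_iff₀ hκ, ← map_sub]
  exact hL _

/-- Let `s n` be the projection of `x n` onto `S`. It is an interior solution, so the quasi-Fejér
property relative to `s n` keeps every later `x m` within a fixed multiple of `D^f(s n, x n)`. The
latter is small for suitable `n`, so the whole tail clusters around `s n`. -/
theorem IsOrbit.cauchySeq (hx : IsOrbit φ ψ L f fn γ x) [CompleteSpace X]
    (H : Setting φ ψ L f β η α fn ε γ) (hX : IsReflexive X)
    {p : X} (hp : p ∈ solutions φ ψ L) (hpU : p ∈ intDom f) (hcoer : Coercive (bregman f p))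
    (hseq : BregmanSeqCondition f)
    (hlim : liminf (fun n => bregmanDist f (solutions φ ψ L) (x n)) atTop = 0)
    {μ : ℝ} (hμ : 0 < μ) (hdom : ∀ n, Dominates f (scale μ f) (fn n)) : CauchySeq x := by
  have hf0 := H.legendre_f.gamma0
  choose s hsS hsU hs using fun n => H.legendre_f.exists_projection hX
    (convex_solutions H.gamma0_φ H.gamma0_ψ) (isClosed_solutions H.gamma0_φ H.gamma0_ψ)
    hp hpU (hx.mem_intDom n)
  have hnn : ∀ {y z : X}, y ∈ intDom f → z ∈ intDom f → 0 ≤ bregmanReal f y z := fun hy hz =>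
    H.legendre_f.gateaux.bregmanReal_nonneg hf0 (intDom_subset_dom f hy) hz
  have hfreq : ∀ j : ℕ, ∃ᶠ n in atTop, bregmanReal f (s n) (x n) < 1 / ((j : ℝ) + 1) := by
    intro j
    have hpos : (0 : ℝ) < 1 / ((j : ℝ) + 1) := by positivity
    have h1 : ∃ᶠ n in atTop,
        bregmanDist f (solutions φ ψ L) (x n) < ((1 / ((j : ℝ) + 1) : ℝ) : EReal) :=
      frequently_lt_of_liminf_lt (by isBoundedDefault) (by rw [hlim]; exact_mod_cast hpos)
    refine h1.mono fun n hn => ?_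
    have h2 := le_bregmanDist hf0 (C := solutions φ ψ L) (hx.mem_intDom n)
      (c := bregmanReal f (s n) (x n)) fun z hz hzf => by
        have h3 := hs n z hz
        have h4 := H.legendre_f.gateaux.bregmanReal_nonneg hf0 hzf (hsU n)
        linarith
    exact EReal.coe_lt_coe_iff.1 (h2.trans_lt hn)
  obtain ⟨k, hk, hkD⟩ := extraction_forall_of_frequently hfreq
  obtain ⟨M, hM⟩ := hx.exists_bregmanReal_le H hp hpU
  -- By the Pythagorean inequality `D^f(p, s n) ≤ D^f(p, x n) ≤ M`.
  have hsb : Bornology.IsBounded (Set.range s) := by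
    refine (isBounded_of_bregmanReal_le hf0 hpU hcoer M).subset ?_
    rintro _ ⟨n, rfl⟩
    exact ⟨hsU n, by linarith [hs n p hp, hM n, hnn (hsU n) (hx.mem_intDom n)]⟩
  have hxb := hx.isBounded H hp hpU hcoer
  -- The factors come from the product of the `1+ηₙ`, from `μf ≽ fₙ` at the initial index and from
  -- `fₘ ≽ αf` at the final one.
  set A := Real.exp (∑' n, η n) * μ / α with hA
  have hcontrol : ∀ n m, n ≤ m → bregmanReal f (s n) (x m) ≤ A * bregmanReal f (s n) (x n) := by
    intro n m hnm
    have h1 := hx.bregmanReal_le_exp_mul H (hsS n) (hsU n) hnm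
    have h2 := (hdom n).bregmanReal_le (hf0.scale hμ) (H.legendre_fn n).gamma0
      (by rw [intDom_scale hμ]) (H.intDom_fn n).ge (hsU n) (hx.mem_intDom n)
    rw [bregmanReal_scale H.legendre_f.gateaux μ _ (hx.mem_intDom n)] at h2
    have h3 := h1.trans (mul_le_mul_of_nonneg_left h2 (Real.exp_pos _).le)
    rw [← le_div_iff₀' H.α_pos] at h3
    refine h3.trans_eq ?_
    rw [hA]; ring
  have hA0 : 0 ≤ A := div_nonneg (mul_nonneg (Real.exp_pos _).le hμ.le) H.α_pos.le
  have hclose : ∀ e : ℝ, 0 < e → ∃ j, ∀ m, k j ≤ m → ‖s (k j) - x m‖ < e := by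
    intro e he
    by_contra hcon
    push Not at hcon
    choose m hm hme using hcon
    have hlim0 : Tendsto (fun j => bregmanReal f (s (k j)) (x (m j))) atTop (𝓝 0) := by
      have h1 : Tendsto (fun j : ℕ => A * (1 / ((j : ℝ) + 1))) atTop (𝓝 0) := by
        simpa using (tendsto_one_div_add_atTop_nhds_zero_nat (𝕜 := ℝ)).const_mul A
      refine squeeze_zero (fun j => hnn (hsU _) (hx.mem_intDom _)) (fun j => ?_) h1
      exact (hcontrol _ _ (hm j)).trans (mul_le_mul_of_nonneg_left (hkD j).le hA0)
    have h2 := hseq (fun j => s (k j)) (fun j => x (m j)) (fun j => hsU _)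
      (fun j => hx.mem_intDom _)
      (hsb.subset (by rintro _ ⟨j, rfl⟩; exact ⟨_, rfl⟩))
      (hxb.subset (by rintro _ ⟨j, rfl⟩; exact ⟨_, rfl⟩)) (by
        have h3 := (continuous_coe_real_ereal.tendsto 0).comp hlim0
        refine h3.congr fun j => ?_
        exact (hf0.bregman_eq (intDom_subset_dom f (hsU _)) (hx.mem_intDom _)).symm)
    have h4 := (tendsto_zero_iff_norm_tendsto_zero.1 h2).eventually_lt_const he
    obtain ⟨j, hj⟩ := h4.exists
    exact absurd (hme j) (not_le.2 hj)
  refine Metric.cauchySeq_iff.2 fun e he => ?_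
  obtain ⟨j, hj⟩ := hclose (e / 2) (by positivity)
  refine ⟨k j, fun m hm n hn => ?_⟩
  rw [dist_eq_norm]
  have h1 := norm_sub_le (s (k j) - x n) (s (k j) - x m)
  rw [sub_sub_sub_cancel_left] at h1
  linarith [hj m hm, hj n hn]

end Convergence

end BregmanFB

theorem theorem3p1 {X Y : Type*}
    [NormedAddCommGroup X] [NormedSpace ℝ X] [CompleteSpace X]
    [NormedAddCommGroup Y] [NormedSpace ℝ Y] [CompleteSpace Y]
    (hX : IsReflexive X) (hY : IsReflexive Y)
    -- the problem: minimize `φ(x) + ψ(L x)`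
    (φ : X → EReal) (hφ : Gamma0 φ)
    (ψ : Y → EReal) (hψ : Gamma0 ψ) (hψint : (intDom ψ).Nonempty)
    (hψdiff : GateauxDiffOnIntDom ψ)
    (L : X →L[ℝ] Y)
    -- the reference Legendre function
    (f : X → EReal) (hf : IsLegendre f)
    (hS : (solutions φ ψ L ∩ intDom f).Nonempty)
    (hL : ∀ x ∈ intDom f, L x ∈ intDom ψ)
    (β : ℝ) (hβ : 0 < β) (hfψ : Dominates f f (scale β (fun x => ψ (L x))))
    -- the variable metrics
    (η : ℕ → ℝ) (hη : ∀ n, 0 ≤ η n) (hηsum : Summable η)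
    (α : ℝ) (hα : 0 < α)
    (fn : ℕ → X → EReal) (hfn : ∀ n, IsLegendre (fn n)) (hfnP : ∀ n, MemP α f (fn n))
    (hfnmono : ∀ n, Dominates f (scale (1 + η n) (fn n)) (fn (n + 1)))
    (hdom : (∀ y ∈ intDom ψ, -((grad ψ y).comp L) ∈ dom (conj φ)) ∨ ∀ n, Cofinite (fn n))
    -- the step sizes
    (ε : ℝ) (hε : 0 < ε) (hε' : ε < α * β / (α * β + 1))
    (γ : ℕ → ℝ) (hγ : ∀ n, ε ≤ γ n ∧ γ n ≤ α * β * (1 - ε))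
    (hγη : ∀ n, (1 + η n) * γ n - γ (n + 1) ≤ α * β * η n)
    (x₀ : X) (hx₀ : x₀ ∈ intDom f)
    (hcoer : ∀ x ∈ intDom f, Coercive (bregman f x)) :
    -- the iteration is well defined: at every step the proximity operator has exactly one value
    ∃ x : ℕ → X, x 0 = x₀ ∧
      (∀ n, prox (fn n) (scale (γ n) φ) (grad (fn n) (x n) - γ n • pullGrad ψ L (x n))
        = {x (n + 1)}) ∧
      (∀ n, x n ∈ intDom f) ∧
      Bornology.IsBounded (Set.range x) ∧
      weakClusterPts x ⊆ solutions φ ψ L ∧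
      ∃ xbar ∈ solutions φ ψ L,
        -- (i)
        ((∃ a, solutions φ ψ L ∩ closure (dom f) = {a}) → WeakTendsto x xbar) ∧
        -- (ii); subtracting `∇fₙ(z)` makes the separation condition invariant under adding affine
        -- functions to the `fₙ`, as all the other hypotheses and the iterates are
        ((∃ g : X → EReal, MemB f g ∧ ∀ n, Dominates f g (fn n)) →
          (∃ z ∈ intDom f, ∀ y₁ ∈ weakClusterPts x, ∀ y₂ ∈ weakClusterPts x,
            (∃ l : ℝ, Tendsto
              (fun n => (grad (fn n) (x n) - grad (fn n) z - γ n • pullGrad ψ L (x n)) (y₁ - y₂))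
              atTop (𝓝 l)) → y₁ = y₂) →
          (solutions φ ψ L ⊆ intDom f ∨
            (IsOpen (dom (conj f)) ∧ WeakSeqContinuousOn (grad (conj f)) (dom (conj f)))) →
          WeakTendsto x xbar) ∧
        -- (iii)
        (BregmanSeqCondition f →
          (UniformlyConvexAt φ xbar ∨
            (UniformlyConvexAt ψ (L xbar) ∧ ∃ κ : ℝ, 0 < κ ∧ ∀ v : X, κ * ‖v‖ ≤ ‖L v‖) ∨
            (liminf (fun n => bregmanDist f (solutions φ ψ L) (x n)) atTop = 0 ∧
              ∃ μ : ℝ, 0 < μ ∧ ∀ n, Dominates f (scale μ f) (fn n))) →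
          Tendsto x atTop (𝓝 xbar)) := by
  have H : Setting φ ψ L f β η α fn ε γ :=
    ⟨hφ, hψ, hψdiff, hf, hL, hβ, hfψ, hη, hηsum, hα, hfn, hfnP, hfnmono, hε, hγ⟩
  obtain ⟨x, hx0, hprox, hx⟩ := H.exists_orbit hX hS hdom hx₀
  obtain ⟨p, hp, hpU⟩ := hS
  have hbdd := hx.isBounded H hp hpU (hcoer p hpU)
  have hW := hx.weakClusterPts_subset H hp hpU
  -- Any weak cluster point will do: each convergence claim forces the limit to be this one.
  obtain ⟨xbar, hbar⟩ := hX.weakClusterPts_nonempty hbdd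
  refine ⟨x, hx0, hprox, hx.mem_intDom, hbdd, hW, xbar, hW hbar, ?_, ?_, ?_⟩
  · rintro ⟨a, ha⟩
    have hWa : ∀ y ∈ weakClusterPts x, y = a := fun y hy => by
      have : y ∈ solutions φ ψ L ∩ closure (dom f) :=
        ⟨hW hy, hx.weakClusterPts_subset_closure hf.gamma0 hy⟩
      rwa [ha] at this
    exact hX.weakTendsto_of_weakClusterPts hbdd fun y hy => by rw [hWa y hy, hWa xbar hbar]
  · rintro - ⟨z, hz, hsep⟩ hcase
    have hWU : weakClusterPts x ⊆ intDom f := by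
      rcases hcase with hsub | ⟨hopen, hcont⟩
      · exact hW.trans hsub
      · obtain ⟨M, hM⟩ := hx.exists_bregmanReal_le H hp hpU
        rintro y ⟨k, -, hy⟩
        exact hf.mem_intDom_of_weakTendsto hX hopen hcont hpU (fun n => hx.mem_intDom (k n))
          (fun n => hM (k n)) hy
    exact hX.weakTendsto_of_weakClusterPts hbdd fun y hy => hsep y hy xbar hbar
      (hx.exists_tendsto_pairing H hγη hz (hW hy) (hWU hy) (hW hbar) (hWU hbar))
  · rintro hseq (hu | ⟨hu, κ, hκ, hLκ⟩ | ⟨hlim, μ, hμ, hdomμ⟩)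
    · exact hx.tendsto_of_uniformlyConvexAt_left H hp hpU (hW hbar) hu
    · exact hx.tendsto_of_uniformlyConvexAt_right H hp hpU (hW hbar) hu hκ hLκ
    · obtain ⟨l, hl⟩ := cauchySeq_tendsto_of_complete
        (hx.cauchySeq H hX hp hpU (hcoer p hpU) hseq hlim hμ hdomμ)
      obtain ⟨k, hk, hkbar⟩ := hbar
      -- The strong limit `l` is also a weak limit, hence equals the cluster point `xbar`.
      have hweak : WeakTendsto x l := fun u => (u.continuous.tendsto l).comp hl
      rwa [hkbar.unique (hweak.comp hk)]
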